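/- **Setting.** Let $F:\mathbb R^d\to\mathbb R^d$ be continuously differentiable with $\langle F(z)-F(z'),z-z'\rangle\ge\mu\|z-z'\|^2$, $\|F(z)-F(z')\|\le L_1\|z-z'\|$ and $\|\nabla F(z)-\nabla F(z')\|_{op}\le L_2\|z-z'\|$ for all $z,z'$, where $\mu,L_1>0$, and let $F(z^*)=0$. Let $\mathcal L\subseteq\mathbb R^{d\times d}$ be a linear subspace with $I\in\mathcal L$ and $\nabla F(z^*)\in\mathcal L$ (for instance $\mathcal L=\mathbb R^{d\times d}$), with orthogonal projection $P$ for the Frobenius inner product $\langle\cdot,\cdot\rangle$. Put $$\mathcal Z=\{B\in\mathcal L:\mu I\preceq\tfrac12(B+B^\top)\preceq L_1I,\ \|B\|_{op}\le L_1\},\qquad \mathcal C=\{X\in\mathcal L:-I\preceq\tfrac12(X+X^\top)\preceq I,\ \|X\|_{op}\le3\}.$$ Let $R>0$ satisfy $\|X\|_F\le R$ for all $X\in\mathcal C$ ($R=3\sqrt d$ always works, and $R=\sqrt d$ works if $\mathcal L$ consists of symmetric matrices). **Oracles.** $\mathsf{LinearSolver}(A,b;\tau)$ is a measurable function that returns some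 $s$ with $\|As-b\|\le\tau\|s\|$ whenever $\frac12(A+A^\top)\succ0$ and $\tau>0$. $\mathsf{ExtEvec}(W;\delta,q)$ and $\mathsf{MaxSvec}(W;\delta,q)$ are randomized procedures (measurable functions of the input matrix and a random seed; the randomized Lanczos method is the intended implementation) which for every input $W\in\mathbb R^{d\times d}$, $\delta>0$, $q\in(0,1)$ return a pair $(\gamma,S)\in\mathbb R\times\mathbb R^{d\times d}$ that, with probability at least $1-q$, satisfies the following. * $\mathsf{ExtEvec}$: either $\gamma\le1$ and $-(1+\delta)I\preceq\frac12(W+W^\top)\preceq(1+\delta)I$; or $\gamma>1$, $-(1+\delta)I\preceq\frac1{2\gamma}(W+W^\top)\preceq(1+\delta)I$, $\|S\|_F\le1$, and $\langle S,W-X\rangle\ge\gamma-1$ for all $X$ with $-I\preceq\frac12(X+X^\top)\preceq I$. * $\mathsf{MaxSvec}$: either $\gamma\le1$ and $\|W\|_{op}\le3(1+\delta)$; or $\gamma>1$, $\|W/\gamma\|_{op}\le3(1+\delta)$, $\|S\|_F\le1$, and $\langle S,W-X\rangle\ge\gamma-1$ for all $X$ with $\|X\|_{op}\le3$. **Method (QNPE).**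 Parameters: $z_0\in\mathbb R^d$, $B_0\in\mathcal Z$, $\alpha_1,\alpha_2\in(0,\frac12)$, $\beta\in(0,1)$, $\sigma_0\ge\frac{\alpha_2\beta}{7.5L_1}$, $p\in(0,1)$, $\rho=\frac1{121}$, $\delta=\frac{\mu}{2L_1}$, and $q_t=\frac{p}{2.5(t+1)\log^2(t+1)}$ for $t\ge1$. Start with the round counter $t=0$, $W_0=\frac1{L_1}(B_0-(L_1+\mu)I)$, $\gamma_0=1$, $S_0=0$. In iteration $k=0,1,2,\dots$, where $B=B_k$: 1. *Line search.* For $\eta>0$ let $z(\eta)=z_k+\mathsf{LinearSolver}(I+\eta B,-\eta F(z_k);\alpha_1\sqrt{1+\eta\mu})$. Let $i\ge0$ be the least integer such that $\eta=\sigma_k\beta^i$ satisfies $\|z(\eta)-z_k+\eta F(z(\eta))\|\le(\alpha_1+\alpha_2)\sqrt{1+\eta\mu}\,\|z(\eta)-z_k\|$. Put $\eta_k=\sigma_k\beta^i$, $\hat z_k=z(\eta_k)$ and $\sigma_{k+1}=\eta_k/\beta$. 2. *Step.* $z_{k+1}=\theta_k(z_k-\eta_kF(\hat z_k))+(1-\theta_k)\hat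 z_k$ with $\theta_k=\frac1{1+2\eta_k\mu}$. 3. *Jacobian approximation.* If $i=0$, put $B_{k+1}=B_k$ and keep $t,W_t,\gamma_t,S_t$. If $i\ge1$, let $\tilde z=z(\eta_k/\beta)$ be the last rejected point, $u=F(\tilde z)-F(z_k)$, $s=\tilde z-z_k$, $\ell(B)=\|u-Bs\|^2/\|s\|^2$, and $G=\frac1{L_1}P\nabla\ell(B_k)$. Put $\tilde G=G$ if $\gamma_t\le1$ and $\tilde G=G+\max\{0,-\frac1{\gamma_t}\langle G,W_t\rangle\}S_t$ if $\gamma_t>1$. Put $W_{t+1}=\frac{R\,(W_t-\rho\tilde G)}{\max\{R,\|W_t-\rho\tilde G\|_F\}}$, and increase $t$ by one. With fresh seeds, independent of the past, call $(\gamma^{(1)},S^{(1)})=\mathsf{ExtEvec}(\frac12(W_t+W_t^\top);\delta,\frac{q_t}2)$ and $(\gamma^{(2)},S^{(2)})=\mathsf{MaxSvec}(W_t;\delta,\frac{q_t}2)$. Let $j=1$ if $\gamma^{(1)}\ge\gamma^{(2)}$ and $j=2$ otherwise, and put $\gamma_t=\gamma^{(j)}$, $S_t=PS^{(j)}$. Put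 $\hat B=W_t$ if $\gamma_t\le1$ and $\hat B=W_t/\gamma_t$ otherwise, and $B_{k+1}=L_1\hat B+(L_1+\mu)I$. **Theorem 6.1.** With probability at least $1-p$ the following holds. (a) (Linear convergence) For all $k\ge0$, $$\|z_{k+1}-z^*\|^2\le\Bigl(1+\frac{4\alpha_2\beta\mu}{15L_1}\Bigr)^{-1}\|z_k-z^*\|^2.$$ (b) (Superlinear convergence) $\lim_{k\to\infty}\frac{\|z_{k+1}-z^*\|^2}{\|z_k-z^*\|^2}=0$ (where $\frac00$ is read as $0$). Moreover, with $$C=\frac{(1+\alpha_1)^2}{2(1-\alpha_1)^2\beta^2(1-(\alpha_1+\alpha_2))},\qquad M=\frac{121\|B_0-\nabla F(z^*)\|_F^2}{L_1^2}+\Bigl(C+2+\frac{15L_1}{2\alpha_2\beta\mu}\Bigr)\frac{L_2^2\|z_0-z^*\|^2}{L_1^2},$$ for all $k\ge0$, $$\|z_k-z^*\|^2\le\Bigl(1+\frac{(1-\beta)\alpha_2\beta\mu}{L_1}\min\Bigl\{\frac{2k}{15},\sqrt{\frac kM}\Bigr\}\Bigr)^{-k}\|z_0-z^*\|^2,$$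 where $\sqrt{k/M}$ is read as $+\infty$ if $M=0$. -/

import Mathlib

open MeasureTheory ProbabilityTheory Filter Topology

namespace QNPE

noncomputable section

/-! ### Vectors and matrices -/

/-- The Euclidean space `ℝ^d`. -/
abbrev Vec (d : ℕ) := EuclideanSpace ℝ (Fin d)

/-- Real `d × d` matrices. -/
abbrev Mat (d : ℕ) := Matrix (Fin d) (Fin d) ℝ

/-- The product (equivalently, Borel) sigma-algebra on matrices. -/
instance instMeasurableSpaceMat (d : ℕ) : MeasurableSpace (Mat d) :=
  inferInstanceAs (MeasurableSpace (Fin d → Fin d → ℝ))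

/-- The matrix-vector product `A v`, as the continuous linear map `v ↦ A v`. -/
def act {d : ℕ} (A : Mat d) : Vec d →L[ℝ] Vec d := Matrix.toEuclideanCLM (n := Fin d) (𝕜 := ℝ) A

/-- The operator norm with respect to the Euclidean norm. -/
def opNorm {d : ℕ} (A : Mat d) : ℝ := ‖act A‖

/-- The Frobenius inner product. -/
def frobInner {d : ℕ} (A B : Mat d) : ℝ := ∑ i, ∑ j, A i j * B i j

/-- The Frobenius norm. -/
def frobNorm {d : ℕ} (A : Mat d) : ℝ := √(frobInner A A)

/-- The symmetric part `(A + Aᵀ) / 2`. -/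
def symPart {d : ℕ} (A : Mat d) : Mat d := (1 / 2 : ℝ) • (A + A.transpose)

/-- The condition `a I ≼ (A + Aᵀ) / 2 ≼ b I` in the Loewner order. -/
def SymBetween {d : ℕ} (a b : ℝ) (A : Mat d) : Prop :=
  (symPart A - a • (1 : Mat d)).PosSemidef ∧ (b • (1 : Mat d) - symPart A).PosSemidef

/-- The Jacobian matrix of `F` at `z`. -/
def jacobian {d : ℕ} (F : Vec d → Vec d) (z : Vec d) : Mat d :=
  (Matrix.toEuclideanCLM (n := Fin d) (𝕜 := ℝ)).symm (fderiv ℝ F z)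

/-- The entries of a matrix as a vector of `ℝ^(d × d)`; the Euclidean structure there is the
Frobenius one. -/
def vec (d : ℕ) : Mat d ≃ₗ[ℝ] EuclideanSpace ℝ (Fin d × Fin d) :=
  (LinearEquiv.curry ℝ ℝ (Fin d) (Fin d)).symm.trans (WithLp.linearEquiv 2 ℝ _).symm

theorem inner_vec {d : ℕ} (A B : Mat d) : inner ℝ (vec d A) (vec d B) = frobInner A B := by
  simp only [PiLp.inner_apply, Fintype.sum_prod_type, frobInner]
  refine Finset.sum_congr rfl fun i _ => Finset.sum_congr rfl fun j _ => ?_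
  exact mul_comm _ _

/-- The orthogonal projection of matrices, for the Frobenius inner product, onto the linear
subspace `S`. -/
def proj {d : ℕ} (S : Submodule ℝ (Mat d)) (A : Mat d) : Mat d :=
  (vec d).symm ((S.map (vec d).toLinearMap).starProjection (vec d A))

theorem proj_mem {d : ℕ} (S : Submodule ℝ (Mat d)) (A : Mat d) : proj S A ∈ S := by
  have h := ((S.map (vec d).toLinearMap).starProjection_apply_mem (vec d A))
  obtain ⟨X, hX, hXA⟩ := h
  rw [proj, ← hXA]
  simpa using hX

theorem frobInner_sub_proj {d : ℕ} (S : Submodule ℝ (Mat d)) (A : Mat d) {X : Mat d}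
    (hX : X ∈ S) : frobInner (A - proj S A) X = 0 := by
  rw [← inner_vec, map_sub, proj, LinearEquiv.apply_symm_apply]
  exact Submodule.starProjection_inner_eq_zero _ _ ⟨X, hX, rfl⟩

/-! ### The two feasible sets -/

/-- The Jacobian feasible set: matrices `B` in the subspace `S` with
`μ I ≼ (B + Bᵀ) / 2 ≼ L₁ I` and operator norm at most `L₁`. -/
def feasible {d : ℕ} (μ L₁ : ℝ) (S : Submodule ℝ (Mat d)) : Set (Mat d) :=
  {B | SymBetween μ L₁ B ∧ opNorm B ≤ L₁ ∧ B ∈ S}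

/-- The translated and rescaled set on which online learning is performed: matrices `X` in the
subspace `S` with `-I ≼ (X + Xᵀ) / 2 ≼ I` and operator norm at most `3`. -/
def learnSet {d : ℕ} (S : Submodule ℝ (Mat d)) : Set (Mat d) :=
  {X | SymBetween (-1) 1 X ∧ opNorm X ≤ 3 ∧ X ∈ S}

/-! ### The oracles -/

/-- The requirement on the oracle `LinearSolver(A, b; τ)`: it returns `s` with
`‖A s - b‖ ≤ τ ‖s‖`. The requirement is only imposed for matrices `A` whose symmetric part is
positive definite, so that every solver correct on all matrices is included. -/
def IsLinearSolver {d : ℕ} (solver : Mat d → Vec d → ℝ → Vec d) : Prop :=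
  ∀ (A : Mat d) (b : Vec d) (τ : ℝ), (symPart A).PosDef → 0 < τ →
    ‖act A (solver A b τ) - b‖ ≤ τ * ‖solver A b τ‖

/-- A randomized matrix oracle with seeds in `Ξ`: from a matrix `W`, an accuracy `δ`, a failure
probability `q` and a random seed it computes a pair `(γ, S)`. -/
abbrev Oracle (d : ℕ) (Ξ : Type*) := Mat d → ℝ → ℝ → Ξ → ℝ × Mat d

/-- The pair `(γ, S)` is a correct answer of the extreme eigenvector oracle at `W`. -/
def ExtEvecGood {d : ℕ} (W : Mat d) (δ : ℝ) (out : ℝ × Mat d) : Prop :=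
  (out.1 ≤ 1 ∧ SymBetween (-(1 + δ)) (1 + δ) W) ∨
  (1 < out.1 ∧ SymBetween (-(1 + δ)) (1 + δ) ((1 / out.1) • W) ∧ frobNorm out.2 ≤ 1 ∧
    ∀ X : Mat d, SymBetween (-1) 1 X → out.1 - 1 ≤ frobInner out.2 (W - X))

/-- The pair `(γ, S)` is a correct answer of the maximal singular vector oracle at `W`. -/
def MaxSvecGood {d : ℕ} (W : Mat d) (δ : ℝ) (out : ℝ × Mat d) : Prop :=
  (out.1 ≤ 1 ∧ opNorm W ≤ 3 * (1 + δ)) ∨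
  (1 < out.1 ∧ opNorm ((1 / out.1) • W) ≤ 3 * (1 + δ) ∧ frobNorm out.2 ≤ 1 ∧
    ∀ X : Mat d, opNorm X ≤ 3 → out.1 - 1 ≤ frobInner out.2 (W - X))

/-- `O` is an `ExtEvec` oracle, for seeds of law `ν`: on every input `(W; δ, q)` its answer is
correct with probability at least `1 - q`. -/
def IsExtEvec {d : ℕ} {Ξ : Type*} [MeasurableSpace Ξ] (ν : Measure Ξ) (O : Oracle d Ξ) : Prop :=
  (∀ δ q : ℝ, Measurable fun x : Mat d × Ξ => O x.1 δ q x.2) ∧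
  ∀ (W : Mat d) (δ q : ℝ), 0 < δ → 0 < q → q < 1 →
    ENNReal.ofReal (1 - q) ≤ ν {ξ | ExtEvecGood W δ (O W δ q ξ)}

/-- `O` is a `MaxSvec` oracle, for seeds of law `ν`: on every input `(W; δ, q)` its answer is
correct with probability at least `1 - q`. -/
def IsMaxSvec {d : ℕ} {Ξ : Type*} [MeasurableSpace Ξ] (ν : Measure Ξ) (O : Oracle d Ξ) : Prop :=
  (∀ δ q : ℝ, Measurable fun x : Mat d × Ξ => O x.1 δ q x.2) ∧
  ∀ (W : Mat d) (δ q : ℝ), 0 < δ → 0 < q → q < 1 →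
    ENNReal.ofReal (1 - q) ≤ ν {ξ | MaxSvecGood W δ (O W δ q ξ)}

/-! ### The method -/

/-- The inputs and parameters of the quasi-Newton proximal extragradient method. -/
structure Method (d : ℕ) where
  /-- the operator -/
  F : Vec d → Vec d
  /-- the linear system oracle of the line search -/
  solver : Mat d → Vec d → ℝ → Vec d
  /-- the linear subspace of structured matrices -/
  S : Submodule ℝ (Mat d)
  /-- initial point -/
  z₀ : Vec d
  /-- initial Jacobian approximation -/
  B₀ : Mat d
  /-- strong monotonicity parameter -/
  μ : ℝ
  /-- Lipschitz constant of the operator -/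
  L₁ : ℝ
  /-- line search parameter: accuracy of the linear solver -/
  α₁ : ℝ
  /-- line search parameter -/
  α₂ : ℝ
  /-- line search parameter: backtracking factor -/
  β : ℝ
  /-- initial trial step size -/
  σ₀ : ℝ
  /-- step size of online learning -/
  ρ : ℝ
  /-- accuracy of the matrix oracles -/
  δ : ℝ
  /-- radius of the ball to which online learning projects -/
  R : ℝ
  /-- `q t` is the failure probability allowed in round `t` of online learning -/
  q : ℕ → ℝ

/-- The state at the beginning of an iteration: iterate `z`, trial step size `σ`, Jacobian
approximation `B`, the index `t` of the current round of online learning (the number of earlier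
iterations that backtracked), and the auxiliary matrix `W` and oracle answer `(γ, S)` of that
round, from which `B` was formed. -/
structure State (d : ℕ) where
  z : Vec d
  σ : ℝ
  B : Mat d
  t : ℕ
  W : Mat d
  γ : ℝ
  S : Mat d

/-- The loss `‖u - B s‖² / ‖s‖²` of a Jacobian approximation `B`. -/
def loss {d : ℕ} (u s : Vec d) (B : Mat d) : ℝ := ‖u - act B s‖ ^ 2 / ‖s‖ ^ 2

/-- The gradient of the loss at `B`, the matrix `-2 (u - B s) sᵀ / ‖s‖²`. -/
def lossGrad {d : ℕ} (u s : Vec d) (B : Mat d) : Mat d :=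
  Matrix.of fun i j => -(2 * (u - act B s) i * s j) / ‖s‖ ^ 2

/-- `lossGrad u s B` is the gradient of the loss at `B` for the Frobenius inner product. -/
theorem hasDerivAt_loss {d : ℕ} (u s : Vec d) (B H : Mat d) :
    HasDerivAt (fun t : ℝ => loss u s (B + t • H)) (frobInner (lossGrad u s B) H) 0 := by
  have h1 : HasDerivAt (fun t : ℝ => u - act (B + t • H) s) (-(act H s)) 0 := by
    have : (fun t : ℝ => u - act (B + t • H) s) = fun t => (u - act B s) - t • act H s := by
      funext t; simp [act, sub_sub]
    rw [this]
    simpa using ((hasDerivAt_id (0 : ℝ)).smul_const (act H s)).const_sub (u - act B s)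
  have h2 := (h1.norm_sq).div_const (‖s‖ ^ 2)
  refine h2.congr_deriv ?_
  have h3 : ∀ i, act H s i = ∑ j, H i j * s j := fun i => rfl
  simp only [zero_smul, add_zero, PiLp.inner_apply, PiLp.neg_apply, h3, frobInner, lossGrad,
    Matrix.of_apply, RCLike.inner_apply, conj_trivial, Finset.mul_sum, Finset.sum_div,
    Finset.sum_mul, neg_mul, ← Finset.sum_neg_distrib]
  refine Finset.sum_congr rfl fun i _ => Finset.sum_congr rfl fun j _ => ?_
  ring

namespace Method

variable {d : ℕ} (Q : Method d)

/-! #### Backtracking line search -/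

/-- The trial point for the step size `η` at the point `z` with the Jacobian approximation `B`:
`z + LinearSolver(I + η B, -η F(z); α₁ √(1 + η μ))`. -/
def trial (z : Vec d) (B : Mat d) (η : ℝ) : Vec d :=
  z + Q.solver (1 + η • B) (-(η • Q.F z)) (Q.α₁ * √(1 + η * Q.μ))

/-- The trial point for the step size `η` passes the test of the line search. -/
def Accepts (z : Vec d) (B : Mat d) (η : ℝ) : Prop :=
  ‖Q.trial z B η - z + η • Q.F (Q.trial z B η)‖
    ≤ (Q.α₁ + Q.α₂) * √(1 + η * Q.μ) * ‖Q.trial z B η - z‖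

/-- The number of backtracking steps: the least `i` such that the step size `σ β^i` is accepted
(and `0` if no step size is, which does not happen when all oracle answers are correct). -/
def numBacktracks (st : State d) : ℕ :=
  sInf {i : ℕ | Q.Accepts st.z st.B (st.σ * Q.β ^ i)}

/-- The accepted step size. -/
def stepSize (st : State d) : ℝ := st.σ * Q.β ^ Q.numBacktracks st

/-- The accepted trial point. -/
def zhat (st : State d) : Vec d := Q.trial st.z st.B (Q.stepSize st)

/-- The last rejected trial point (meaningful if the line search backtracked). -/
def ztilde (st : State d) : Vec d :=
  Q.trial st.z st.B (st.σ * Q.β ^ (Q.numBacktracks st - 1))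

/-- The next iterate `θ (z - η F(ẑ)) + (1 - θ) ẑ` with `θ = 1 / (1 + 2 η μ)`. -/
def nextPoint (st : State d) : Vec d :=
  (1 / (1 + 2 * Q.stepSize st * Q.μ)) • (st.z - Q.stepSize st • Q.F (Q.zhat st))
    + (1 - 1 / (1 + 2 * Q.stepSize st * Q.μ)) • Q.zhat st

/-! #### Jacobian approximation update (for iterations that backtracked) -/

/-- The projected and rescaled gradient of the loss `‖u - B s‖² / ‖s‖²`, where `s = z̃ - z` and
`u = F(z̃) - F(z)`. -/
def grad (st : State d) : Mat d :=
  (1 / Q.L₁) • proj Q.S (lossGrad (Q.F (Q.ztilde st) - Q.F st.z) (Q.ztilde st - st.z) st.B)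

/-- The surrogate gradient. -/
def surrogateGrad (st : State d) : Mat d :=
  if st.γ ≤ 1 then Q.grad st
  else Q.grad st + max 0 (-(1 / st.γ) * frobInner (Q.grad st) st.W) • st.S

/-- The next auxiliary matrix: a gradient step, projected onto the Frobenius ball of
radius `R` around `0`. -/
def nextW (st : State d) : Mat d :=
  (Q.R / max (frobNorm (st.W - Q.ρ • Q.surrogateGrad st)) Q.R) •
    (st.W - Q.ρ • Q.surrogateGrad st)

/-- The approximate separation oracle called in round `t` at the matrix `W`, with the seeds
`ξ₁` and `ξ₂` for the two oracles it is composed of. -/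
def separate {Ξ₁ Ξ₂ : Type*} (ext : Oracle d Ξ₁) (svec : Oracle d Ξ₂) (t : ℕ) (W : Mat d)
    (ξ₁ : Ξ₁) (ξ₂ : Ξ₂) : ℝ × Mat d :=
  let o₁ := ext (symPart W) Q.δ (Q.q t / 2) ξ₁
  let o₂ := svec W Q.δ (Q.q t / 2) ξ₂
  if o₂.1 ≤ o₁.1 then (o₁.1, proj Q.S o₁.2) else (o₂.1, proj Q.S o₂.2)

/-- The Jacobian approximation formed (without division by `1 + δ`) from an auxiliary matrix `W`
and the number `γ` returned by the separation oracle. -/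
def approx (W : Mat d) (γ : ℝ) : Mat d :=
  Q.L₁ • (if γ ≤ 1 then W else (1 / γ) • W) + (Q.L₁ + Q.μ) • (1 : Mat d)

/-! #### Iteration and runs -/

/-- The initial state. No oracle is called in round `0`, which is treated as the case `γ ≤ 1`. -/
def init : State d where
  z := Q.z₀
  σ := Q.σ₀
  B := Q.B₀
  t := 0
  W := (1 / Q.L₁) • (Q.B₀ - (Q.L₁ + Q.μ) • (1 : Mat d))
  γ := 1
  S := 0

/-- One iteration: line search, extragradient step and, if the line search backtracked, a round
of online learning, in which the two matrix oracles use the seeds `ξ₁` and `ξ₂`. -/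
def step {Ξ₁ Ξ₂ : Type*} (ext : Oracle d Ξ₁) (svec : Oracle d Ξ₂) (ξ₁ : Ξ₁) (ξ₂ : Ξ₂)
    (st : State d) : State d :=
  if Q.numBacktracks st = 0 then
    { st with z := Q.nextPoint st, σ := Q.stepSize st / Q.β }
  else
    let out := Q.separate ext svec (st.t + 1) (Q.nextW st) ξ₁ ξ₂
    { z := Q.nextPoint st
      σ := Q.stepSize st / Q.β
      B := Q.approx (Q.nextW st) out.1
      t := st.t + 1
      W := Q.nextW st
      γ := out.1
      S := out.2 }

/-- The state at the beginning of iteration `k`, when the oracle calls in iteration `j` (if any)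
use the seeds `ξ₁ j` and `ξ₂ j`. -/
def run {Ξ₁ Ξ₂ : Type*} (ext : Oracle d Ξ₁) (svec : Oracle d Ξ₂) (ξ₁ : ℕ → Ξ₁) (ξ₂ : ℕ → Ξ₂) :
    ℕ → State d
  | 0 => Q.init
  | k + 1 => Q.step ext svec (ξ₁ k) (ξ₂ k) (run ext svec ξ₁ ξ₂ k)

/-! #### The constants of the convergence rate -/

/-- The constant `C = (1 + α₁)² / (2 (1 - α₁)² β² (1 - (α₁ + α₂)))`. -/
def constC : ℝ :=
  (1 + Q.α₁) ^ 2 / (2 * (1 - Q.α₁) ^ 2 * Q.β ^ 2 * (1 - (Q.α₁ + Q.α₂)))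

/-- The quantity
`121 ‖B₀ - ∇F(z*)‖_F² / L₁² + (C + 2 + 15 L₁ / (2 α₂ β μ)) L₂² ‖z₀ - z*‖² / L₁²`. -/
def constM (L₂ : ℝ) (zs : Vec d) : ℝ :=
  121 * frobNorm (Q.B₀ - jacobian Q.F zs) ^ 2 / Q.L₁ ^ 2
    + (Q.constC + 2 + 15 * Q.L₁ / (2 * Q.α₂ * Q.β * Q.μ))
      * (L₂ ^ 2 * ‖Q.z₀ - zs‖ ^ 2 / Q.L₁ ^ 2)

/-- `min {2 k / 15, √(k / m)}`, where `k / m` is read as `+∞` if `m = 0`. -/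
def rate (m : ℝ) (k : ℕ) : ℝ :=
  if m = 0 then 2 / 15 * (k : ℝ) else min (2 / 15 * (k : ℝ)) √((k : ℝ) / m)

end Method

end

end QNPE

/-!
The proof separates the randomness from the dynamics.

*Dynamics.* Suppose that all answers of the matrix oracles are correct. Then every Jacobian
approximation `B` has symmetric part at least `μ / 2` and operator norm at most `6.5 L₁`
(`inner_B_ge`, `opNorm_B_le`), so that the line search terminates with a step size of at least
`α₂ β / (7.5 L₁)`. An accepted step is an inexact proximal extragradient step, which gives
`(1 + 2 η μ) ‖z⁺ - z*‖² + (1 - α₁ - α₂) ‖ẑ - z‖² ≤ ‖z - z*‖²` (`extragradient_step`). This is the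
linear rate, and superlinear convergence amounts to `η → ∞`.

When the line search backtracks, the rejected trial point shows that the inverse of the step size
is at most `√ℓ / (α₂ β)`, where `ℓ` is the loss of `B` at that point
(`lt_stepSize_mul_sqrt_loss`); otherwise the inverse of the step size shrinks by the factor `β`.
It therefore suffices to bound the total loss. This is an online learning problem, solved by
projected gradient descent on a ball, with a separation oracle for the true feasible set: the
surrogate gradient majorizes the regret (`State.Valid.frobInner_grad_le`) and its norm is at most
`11 √ℓ / L₁`, whence with `ρ = 1 / 121` the loss of a round is at most twice the loss of the Jacobian
`H` at the solution, plus a telescoping term (`loss_le`). The loss of `H` is at most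
`L₂² (‖z - z*‖ + ‖z̃ - z‖ / 2)²`, which by the Cauchy-Schwarz inequality is controlled by the
decrease of `‖z - z*‖²` (`two_mul_loss_jacobian_le`). Both parts combine to a potential whose
decrease bounds the loss of each iteration (`roundLoss_le_potential_sub`). Its initial value is at
most `2 L₁² M`. If the first trial step size is accepted, then the value after the first
iteration counts, which is at most `L₁² M`; otherwise the initial trial step size does not enter the
bound on the sum of the inverse step sizes, which makes up for the factor `2`
(`sum_inv_stepSize_le`). The explicit rate follows because `∏ (1 + 2 η μ)` is smallest, for a given
sum of the `1 / η`, when all `η` are equal (`pow_le_prod_one_add_div`).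

*Randomness.* The state at the beginning of an iteration is a measurable function of the earlier
seeds, hence independent of the seeds of that iteration (`indepFun_run`). A round of online learning
takes place in at most one iteration, so it fails with probability at most `q t`
(`measure_exists_failure_le`), and `∑ q t ≤ p` because `∑ 1 / (t log² t) ≤ 2.5`
(`sum_one_div_mul_log_sq_le`).
-/

namespace QNPE

variable {d : ℕ}

/-! ### Matrices as operators, and the Frobenius geometry -/

@[simp] theorem act_add (A B : Mat d) : act (A + B) = act A + act B := by simp [act]

@[simp] theorem act_sub (A B : Mat d) : act (A - B) = act A - act B := by simp [act]

@[simp] theorem act_smul (c : ℝ) (A : Mat d) : act (c • A) = c • act A := by simp [act]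

@[simp] theorem act_one : act (1 : Mat d) = 1 := by simp [act]

@[simp] theorem act_jacobian (F : Vec d → Vec d) (z : Vec d) :
    act (jacobian F z) = fderiv ℝ F z := by simp [act, jacobian]

theorem norm_act_le (A : Mat d) (x : Vec d) : ‖act A x‖ ≤ opNorm A * ‖x‖ :=
  (act A).le_opNorm x

theorem inner_act_transpose (A : Mat d) (x : Vec d) :
    inner ℝ x (act A.transpose x) = inner ℝ x (act A x) := by
  simp only [act, Matrix.inner_toEuclideanCLM]
  rw [Matrix.mulVec_transpose, dotProduct_comm, Matrix.dotProduct_mulVec]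

theorem inner_act_symPart (A : Mat d) (x : Vec d) :
    inner ℝ x (act (symPart A) x) = inner ℝ x (act A x) := by
  simp only [symPart, act_smul, act_add, smul_apply, add_apply,
    inner_smul_right, inner_add_right, inner_act_transpose]
  ring

theorem isHermitian_symPart (A : Mat d) : (symPart A).IsHermitian := by
  ext i j
  simp only [symPart, Matrix.conjTranspose_apply, Matrix.smul_apply, Matrix.add_apply,
    Matrix.transpose_apply, smul_eq_mul, star_trivial]
  ring

@[simp] theorem symPart_symPart (A : Mat d) : symPart (symPart A) = symPart A := by
  ext i j
  simp [symPart]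
  ring

theorem posSemidef_iff_inner {A : Mat d} (hA : A.IsHermitian) :
    A.PosSemidef ↔ ∀ x : Vec d, 0 ≤ inner ℝ x (act A x) := by
  rw [Matrix.posSemidef_iff_dotProduct_mulVec]
  simp only [hA, true_and, star_trivial, act, Matrix.inner_toEuclideanCLM]
  exact ⟨fun h x => h _, fun h x => h (WithLp.toLp 2 x)⟩

theorem posDef_symPart {A : Mat d} (h : ∀ x : Vec d, x ≠ 0 → 0 < inner ℝ x (act A x)) :
    (symPart A).PosDef := by
  refine Matrix.PosDef.of_dotProduct_mulVec_pos (isHermitian_symPart A) fun {x} hx => ?_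
  have h1 := h (WithLp.toLp 2 x) (by simpa using hx)
  rw [← inner_act_symPart] at h1
  simpa only [act, Matrix.inner_toEuclideanCLM, star_trivial] using h1

theorem symBetween_iff {a b : ℝ} {A : Mat d} : SymBetween a b A ↔
    (∀ x : Vec d, a * ‖x‖ ^ 2 ≤ inner ℝ x (act A x)) ∧
      ∀ x : Vec d, inner ℝ x (act A x) ≤ b * ‖x‖ ^ 2 := by
  have h1 : ∀ c : ℝ, (c • (1 : Mat d)).IsHermitian := fun c => by
    simp [Matrix.IsHermitian]
  rw [SymBetween, posSemidef_iff_inner ((isHermitian_symPart A).sub (h1 a)),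
    posSemidef_iff_inner ((h1 b).sub (isHermitian_symPart A))]
  simp [inner_sub_right, inner_smul_right, inner_act_symPart]

theorem symBetween_symPart {a b : ℝ} {A : Mat d} :
    SymBetween a b (symPart A) ↔ SymBetween a b A := by
  simp [SymBetween]

theorem frobNorm_eq (A : Mat d) : frobNorm A = ‖vec d A‖ := by
  rw [frobNorm, ← inner_vec, real_inner_self_eq_norm_sq, Real.sqrt_sq (norm_nonneg _)]

theorem frobNorm_nonneg (A : Mat d) : 0 ≤ frobNorm A := Real.sqrt_nonneg _

theorem frobInner_add_left (A B C : Mat d) :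
    frobInner (A + B) C = frobInner A C + frobInner B C := by
  simp only [← inner_vec, map_add, inner_add_left]

theorem frobInner_sub_left (A B C : Mat d) :
    frobInner (A - B) C = frobInner A C - frobInner B C := by
  simp only [← inner_vec, map_sub, inner_sub_left]

theorem frobInner_smul_left (c : ℝ) (A C : Mat d) :
    frobInner (c • A) C = c * frobInner A C := by
  simp only [← inner_vec, map_smul, real_inner_smul_left]

theorem frobInner_sub_right (A B C : Mat d) :
    frobInner A (B - C) = frobInner A B - frobInner A C := by
  simp only [← inner_vec, map_sub, inner_sub_right]

theorem frobInner_smul_right (c : ℝ) (A C : Mat d) :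
    frobInner A (c • C) = c * frobInner A C := by
  simp only [← inner_vec, map_smul, real_inner_smul_right]

theorem frobNorm_smul (c : ℝ) (A : Mat d) : frobNorm (c • A) = |c| * frobNorm A := by
  simp only [frobNorm_eq, map_smul, norm_smul, Real.norm_eq_abs]

theorem frobNorm_add_le (A B : Mat d) : frobNorm (A + B) ≤ frobNorm A + frobNorm B := by
  simp only [frobNorm_eq, map_add, norm_add_le]

theorem frobInner_proj_left (S : Submodule ℝ (Mat d)) (A : Mat d) {X : Mat d} (hX : X ∈ S) :
    frobInner (proj S A) X = frobInner A X := by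
  have := frobInner_sub_proj S A hX
  rw [frobInner_sub_left] at this
  linarith

theorem frobNorm_proj_le (S : Submodule ℝ (Mat d)) (A : Mat d) :
    frobNorm (proj S A) ≤ frobNorm A := by
  rw [frobNorm_eq, frobNorm_eq, proj, LinearEquiv.apply_symm_apply]
  exact Submodule.norm_starProjection_apply_le _ _

/-- Projecting `Y` to the ball of radius `R` does not increase the distance to a point `X` of
the ball. -/
theorem frobNorm_ball_proj_sub_le {R : ℝ} (hR : 0 < R) (X Y : Mat d) (hX : frobNorm X ≤ R) :
    frobNorm ((R / max (frobNorm Y) R) • Y - X) ≤ frobNorm (Y - X) := by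
  simp only [frobNorm_eq, map_sub, map_smul] at *
  set x := vec d X
  set y := vec d Y
  rcases le_total ‖y‖ R with h | h
  · rw [max_eq_right h, div_self hR.ne', one_smul]
  rw [max_eq_left h]
  have hy : 0 < ‖y‖ := hR.trans_le h
  refine abs_le_of_sq_le_sq' ?_ (norm_nonneg _) |>.2
  set c := R / ‖y‖ with hc
  have hc0 : 0 < c := by positivity
  have hc1 : c ≤ 1 := (div_le_one hy).2 h
  have hcy : c * ‖y‖ = R := by rw [hc]; field_simp
  rw [norm_sub_sq_real, norm_sub_sq_real, norm_smul, real_inner_smul_left, Real.norm_eq_abs,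
    abs_of_pos hc0]
  have h1 : inner ℝ y x ≤ ‖y‖ * R := (real_inner_le_norm y x).trans (by gcongr)
  -- with `R = c ‖y‖`, the difference is at least `(1 - c)² ‖y‖²`
  nlinarith [mul_le_mul_of_nonneg_left h1 (sub_nonneg.2 hc1), sq_nonneg ((1 - c) * ‖y‖)]

/-! ### The loss -/

theorem frobInner_lossGrad (u s : Vec d) (B X : Mat d) :
    frobInner (lossGrad u s B) X = -(2 * inner ℝ (u - act B s) (act X s)) / ‖s‖ ^ 2 := by
  have h3 : ∀ i, act X s i = ∑ j, X i j * s j := fun i => rfl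
  simp only [frobInner, lossGrad, PiLp.inner_apply, h3, Matrix.of_apply, RCLike.inner_apply,
    conj_trivial, Finset.mul_sum, Finset.sum_mul, ← Finset.sum_neg_distrib, Finset.sum_div]
  refine Finset.sum_congr rfl fun i _ => Finset.sum_congr rfl fun j _ => ?_
  ring

theorem loss_nonneg (u s : Vec d) (B : Mat d) : 0 ≤ loss u s B := by
  unfold loss; positivity

theorem sqrt_loss (u s : Vec d) (B : Mat d) : √(loss u s B) = ‖u - act B s‖ / ‖s‖ := by
  rw [loss, ← div_pow, Real.sqrt_sq (by positivity)]

theorem frobNorm_lossGrad_le (u s : Vec d) (B : Mat d) :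
    frobNorm (lossGrad u s B) ≤ 2 * √(loss u s B) := by
  rw [frobNorm]
  refine (Real.sqrt_le_left (by positivity)).2 ?_
  rw [mul_pow, Real.sq_sqrt (loss_nonneg _ _ _)]
  have h : frobInner (lossGrad u s B) (lossGrad u s B)
      = 4 * ‖u - act B s‖ ^ 2 * ‖s‖ ^ 2 / (‖s‖ ^ 2) ^ 2 := by
    generalize hr : (‖s‖ ^ 2) ^ 2 = r
    rw [EuclideanSpace.real_norm_sq_eq, EuclideanSpace.real_norm_sq_eq s]
    have hr' : ‖s‖ ^ 4 = r := by rw [← hr]; ring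
    simp only [frobInner, lossGrad, Matrix.of_apply, Finset.mul_sum, Finset.sum_mul,
      Finset.sum_div]
    rw [Finset.sum_comm]
    refine Finset.sum_congr rfl fun i _ => Finset.sum_congr rfl fun j _ => ?_
    rw [← hr']
    ring
  rw [h, loss]
  rcases eq_or_ne ‖s‖ 0 with h0 | h0
  · simp [h0]
  · apply le_of_eq; field_simp; ring

theorem loss_sub_loss_le (u s : Vec d) (B H : Mat d) :
    loss u s B - loss u s H ≤ frobInner (lossGrad u s B) (B - H) := by
  rw [frobInner_lossGrad, loss, loss, ← sub_div]
  refine div_le_div_of_nonneg_right ?_ (by positivity)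
  have : u - act H s = (u - act B s) + act (B - H) s := by simp
  rw [this, norm_add_sq_real]
  nlinarith [sq_nonneg ‖act (B - H) s‖]

theorem abs_frobInner_lossGrad_le (u s : Vec d) (B X : Mat d) :
    |frobInner (lossGrad u s B) X| ≤ 2 * √(loss u s B) * opNorm X := by
  rw [frobInner_lossGrad, sqrt_loss, abs_div, abs_neg, abs_mul, abs_two, abs_of_nonneg
    (by positivity : (0 : ℝ) ≤ ‖s‖ ^ 2)]
  have h1 := (abs_real_inner_le_norm (u - act B s) (act X s)).trans
    (mul_le_mul_of_nonneg_left (norm_act_le X s) (norm_nonneg _))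
  rcases eq_or_ne ‖s‖ 0 with h0 | h0
  · simp [h0]
  have : 0 < ‖s‖ := lt_of_le_of_ne (norm_nonneg _) h0.symm
  rw [div_le_iff₀ (by positivity)]
  calc 2 * |inner ℝ (u - act B s) (act X s)|
      ≤ 2 * (‖u - act B s‖ * (opNorm X * ‖s‖)) := by gcongr
    _ = _ := by field_simp

/-! ### The standing assumptions and the Jacobian at the solution -/

/-- The deterministic hypotheses on the problem and the parameters. The two inequalities
`μ ≤ L₁` and `0 ≤ L₂` follow from the others when `d ≠ 0`. -/
structure Method.Admissible (Q : Method d) (zs : Vec d) (L₂ : ℝ) : Prop where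
  contDiff : ContDiff ℝ 1 Q.F
  μ_pos : 0 < Q.μ
  mono : ∀ z z' : Vec d, Q.μ * ‖z - z'‖ ^ 2 ≤ inner ℝ (Q.F z - Q.F z') (z - z')
  L₁_pos : 0 < Q.L₁
  lip : ∀ z z' : Vec d, ‖Q.F z - Q.F z'‖ ≤ Q.L₁ * ‖z - z'‖
  jac : ∀ z z' : Vec d, opNorm (jacobian Q.F z - jacobian Q.F z') ≤ L₂ * ‖z - z'‖
  zero : Q.F zs = 0
  one_mem : (1 : Mat d) ∈ Q.S
  jac_mem : jacobian Q.F zs ∈ Q.S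
  B₀_mem : Q.B₀ ∈ feasible Q.μ Q.L₁ Q.S
  R_pos : 0 < Q.R
  ball : ∀ X ∈ learnSet Q.S, frobNorm X ≤ Q.R
  α₁_mem : Q.α₁ ∈ Set.Ioo (0 : ℝ) (1 / 2)
  α₂_mem : Q.α₂ ∈ Set.Ioo (0 : ℝ) (1 / 2)
  β_mem : Q.β ∈ Set.Ioo (0 : ℝ) 1
  σ₀_ge : Q.α₂ * Q.β / (7.5 * Q.L₁) ≤ Q.σ₀
  solver : IsLinearSolver Q.solver
  ρ_eq : Q.ρ = 1 / 121
  δ_eq : Q.δ = Q.μ / (2 * Q.L₁)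
  μ_le : Q.μ ≤ Q.L₁
  L₂_nonneg : 0 ≤ L₂

namespace Method.Admissible

variable {Q : Method d} {zs : Vec d} {L₂ : ℝ} (h : Q.Admissible zs L₂)
include h

theorem δ_pos : 0 < Q.δ := by
  rw [h.δ_eq]; have := h.μ_pos; have := h.L₁_pos; positivity

theorem δ_le : Q.δ ≤ 1 / 2 := by
  rw [h.δ_eq, div_le_iff₀ (by linarith [h.L₁_pos])]; linarith [h.μ_le]

theorem L₁_mul_δ : Q.L₁ * Q.δ = Q.μ / 2 := by
  rw [h.δ_eq]; have := h.L₁_pos; field_simp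

theorem hasFDerivAt (z : Vec d) : HasFDerivAt Q.F (fderiv ℝ Q.F z) z :=
  (h.contDiff.differentiable one_ne_zero z).hasFDerivAt

theorem hasDerivAt_line (z v : Vec d) (t : ℝ) :
    HasDerivAt (fun t : ℝ => Q.F (z + t • v)) (fderiv ℝ Q.F (z + t • v) v) t := by
  have h1 : HasDerivAt (fun t : ℝ => z + t • v) v t := by
    simpa using ((hasDerivAt_id t).smul_const v).const_add z
  exact (h.hasFDerivAt _).comp_hasDerivAt t h1

theorem inner_jacobian_ge (z v : Vec d) :
    Q.μ * ‖v‖ ^ 2 ≤ inner ℝ v (act (jacobian Q.F z) v) := by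
  have h1 := h.hasDerivAt_line z v 0
  rw [zero_smul, add_zero] at h1
  have h2 := ((hasDerivAt_iff_tendsto_slope_zero.1 h1).inner tendsto_const_nhds :
    Tendsto _ _ (𝓝 (inner ℝ (fderiv ℝ Q.F z v) v)))
  rw [act_jacobian, real_inner_comm]
  refine ge_of_tendsto h2 ?_
  filter_upwards [self_mem_nhdsWithin] with t ht
  have ht : t ≠ 0 := ht
  have h3 := h.mono (z + t • v) z
  simp only [add_sub_cancel_left, norm_smul, Real.norm_eq_abs, mul_pow, sq_abs,
    inner_smul_right] at h3
  simp only [zero_add, zero_smul, add_zero, real_inner_smul_left]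
  have : t⁻¹ * inner ℝ (Q.F (z + t • v) - Q.F z) v
      = (t⁻¹) ^ 2 * (t * inner ℝ (Q.F (z + t • v) - Q.F z) v) := by field_simp
  rw [this]
  calc Q.μ * ‖v‖ ^ 2 = (t⁻¹) ^ 2 * (Q.μ * (t ^ 2 * ‖v‖ ^ 2)) := by field_simp
    _ ≤ _ := by gcongr

theorem opNorm_jacobian_le (z : Vec d) : opNorm (jacobian Q.F z) ≤ Q.L₁ := by
  rw [opNorm, act_jacobian]
  have hl : LipschitzWith (Real.toNNReal Q.L₁) Q.F := LipschitzWith.of_dist_le_mul fun x y => by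
    rw [dist_eq_norm, dist_eq_norm, Real.coe_toNNReal _ h.L₁_pos.le]; exact h.lip x y
  simpa [h.L₁_pos.le] using norm_fderiv_le_of_lipschitz ℝ (x₀ := z) hl

/-- The linearization of `F` at the solution has an error controlled by the average distance of
the segment from `z` to `z + s` to the solution. -/
theorem norm_sub_jacobian_le (z s : Vec d) :
    ‖Q.F (z + s) - Q.F z - act (jacobian Q.F zs) s‖
      ≤ L₂ * (‖z - zs‖ + ‖s‖ / 2) * ‖s‖ := by
  have h1 : ∀ t : ℝ, HasDerivAt
      (fun t : ℝ => Q.F (z + t • s) - Q.F z - t • act (jacobian Q.F zs) s)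
      (fderiv ℝ Q.F (z + t • s) s - act (jacobian Q.F zs) s) t := fun t =>
    (((h.hasDerivAt_line z s t).sub_const (Q.F z)).sub
      ((hasDerivAt_id t).smul_const (act (jacobian Q.F zs) s))).congr_deriv (by simp)
  have h2 : ∀ t : ℝ, HasDerivAt
      (fun t : ℝ => L₂ * (‖z - zs‖ * t + t ^ 2 / 2 * ‖s‖) * ‖s‖)
      (L₂ * (‖z - zs‖ + t * ‖s‖) * ‖s‖) t := fun t => by
    have h3 : HasDerivAt (fun t : ℝ => ‖z - zs‖ * t + t ^ 2 / 2 * ‖s‖)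
        (‖z - zs‖ * 1 + (2 * t) / 2 * ‖s‖) t := by
      have h4 := ((hasDerivAt_pow 2 t).div_const 2).mul_const ‖s‖
      exact (((hasDerivAt_id t).const_mul ‖z - zs‖).add h4).congr_deriv (by simp)
    exact ((h3.const_mul L₂).mul_const ‖s‖).congr_deriv (by ring)
  have := image_norm_le_of_norm_deriv_right_le_deriv_boundary (a := 0) (b := 1)
    (fun t _ => (h1 t).continuousAt.continuousWithinAt)
    (fun t _ => (h1 t).hasDerivWithinAt) (by simp) h2 (fun t ht => ?_)
    (Set.right_mem_Icc.2 zero_le_one)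
  · rw [one_smul, one_smul] at this
    exact this.trans_eq (by ring)
  · rw [← act_jacobian, ← sub_apply, ← act_sub]
    refine (norm_act_le _ _).trans (mul_le_mul_of_nonneg_right ?_ (norm_nonneg _))
    refine (h.jac _ _).trans (mul_le_mul_of_nonneg_left ?_ h.L₂_nonneg)
    calc ‖z + t • s - zs‖ = ‖(z - zs) + t • s‖ := by congr 1; abel
      _ ≤ ‖z - zs‖ + ‖t • s‖ := norm_add_le _ _
      _ = _ := by rw [norm_smul, Real.norm_eq_abs, abs_of_nonneg ht.1]

theorem loss_jacobian_le (z z' : Vec d) :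
    loss (Q.F z' - Q.F z) (z' - z) (jacobian Q.F zs)
      ≤ L₂ ^ 2 * (‖z - zs‖ + ‖z' - z‖ / 2) ^ 2 := by
  have h1 := h.norm_sub_jacobian_le z (z' - z)
  rw [add_sub_cancel] at h1
  have h0 := h.L₂_nonneg
  rw [loss]
  refine div_le_of_le_mul₀ (by positivity) (by positivity) ?_
  rw [← mul_pow, ← mul_pow]
  gcongr

/-- The loss of a matrix of operator norm at most `6.5 L₁`. -/
theorem sqrt_loss_le {B : Mat d} (hB : opNorm B ≤ 6.5 * Q.L₁) (z z' : Vec d) :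
    √(loss (Q.F z' - Q.F z) (z' - z) B) ≤ 7.5 * Q.L₁ := by
  rw [sqrt_loss]
  have hL := h.L₁_pos
  refine div_le_of_le_mul₀ (by positivity) (by positivity) ?_
  have h1 := h.lip z' z
  have h2 := norm_act_le B (z' - z)
  have h3 := mul_le_mul_of_nonneg_right hB (norm_nonneg (z' - z))
  have h4 := norm_sub_le (Q.F z' - Q.F z) (act B (z' - z))
  linarith

end Method.Admissible

/-! ### Separation oracle -/

theorem opNorm_nonneg (A : Mat d) : 0 ≤ opNorm A := norm_nonneg _

theorem opNorm_add_le (A B : Mat d) : opNorm (A + B) ≤ opNorm A + opNorm B := by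
  simp only [opNorm, act_add]; exact norm_add_le _ _

theorem opNorm_sub_le (A B : Mat d) : opNorm (A - B) ≤ opNorm A + opNorm B := by
  simp only [opNorm, act_sub]; exact norm_sub_le _ _

theorem opNorm_smul (c : ℝ) (A : Mat d) : opNorm (c • A) = |c| * opNorm A := by
  simp only [opNorm, act_smul, norm_smul, Real.norm_eq_abs]

theorem opNorm_one_le : opNorm (1 : Mat d) ≤ 1 := by
  rw [opNorm, act_one]; exact ContinuousLinearMap.norm_id_le

/-- The matrix equal to `W` if `γ ≤ 1` and to `W / γ` otherwise. -/
noncomputable def scaled (W : Mat d) (γ : ℝ) : Mat d := if γ ≤ 1 then W else (1 / γ) • W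

theorem scaled_eq (W : Mat d) (γ : ℝ) : scaled W γ = (1 / max 1 γ) • W := by
  rw [scaled]
  split_ifs with h
  · simp [max_eq_left h]
  · rw [max_eq_right (not_le.1 h).le]

theorem symPart_smul (c : ℝ) (A : Mat d) : symPart (c • A) = c • symPart A := by
  simp only [symPart, Matrix.transpose_smul, ← smul_add, smul_comm c]

theorem SymBetween.smul {b c : ℝ} {A : Mat d} (h : SymBetween (-b) b A) (hb : 0 ≤ b)
    (hc : 0 ≤ c) (hc1 : c ≤ 1) : SymBetween (-b) b (c • A) := by
  rw [symBetween_iff] at *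
  simp only [act_smul, smul_apply, inner_smul_right]
  refine ⟨fun x => ?_, fun x => ?_⟩
  · have := mul_le_mul_of_nonneg_left (h.1 x) hc
    nlinarith [mul_nonneg (sub_nonneg.2 hc1) (mul_nonneg hb (sq_nonneg ‖x‖))]
  · have := mul_le_mul_of_nonneg_left (h.2 x) hc
    nlinarith [mul_nonneg (sub_nonneg.2 hc1) (mul_nonneg hb (sq_nonneg ‖x‖))]

theorem scaled_eq_smul_scaled (W : Mat d) {γ γ' : ℝ} :
    scaled W γ' = (max 1 γ / max 1 γ') • scaled W γ := by
  have : (0 : ℝ) < max 1 γ := lt_max_of_lt_left one_pos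
  rw [scaled_eq, scaled_eq, smul_smul]
  congr 1
  field_simp

theorem SymBetween.scaled_mono {b γ γ' : ℝ} {W : Mat d} (h : SymBetween (-b) b (scaled W γ))
    (hb : 0 ≤ b) (hγ : γ ≤ γ') : SymBetween (-b) b (scaled W γ') := by
  rw [scaled_eq_smul_scaled W (γ := γ)]
  exact h.smul hb (by positivity)
    ((div_le_one (lt_max_of_lt_left one_pos)).2 (max_le_max_left _ hγ))

theorem opNorm_scaled_anti {γ γ' : ℝ} (W : Mat d) (hγ : γ ≤ γ') :
    opNorm (scaled W γ') ≤ opNorm (scaled W γ) := by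
  have h0 : (0 : ℝ) < max 1 γ := lt_max_of_lt_left one_pos
  rw [scaled_eq_smul_scaled W (γ := γ), opNorm_smul, abs_of_nonneg (by positivity)]
  exact mul_le_of_le_one_left (opNorm_nonneg _)
    ((div_le_one (lt_max_of_lt_left one_pos)).2 (max_le_max_left _ hγ))

theorem ExtEvecGood.symBetween {W : Mat d} {δ : ℝ} {out : ℝ × Mat d} (h : ExtEvecGood W δ out) :
    SymBetween (-(1 + δ)) (1 + δ) (scaled W out.1) := by
  rcases h with h | h
  · rw [scaled, if_pos h.1]; exact h.2
  · rw [scaled, if_neg h.1.not_ge]; exact h.2.1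

theorem MaxSvecGood.opNorm_le {W : Mat d} {δ : ℝ} {out : ℝ × Mat d} (h : MaxSvecGood W δ out) :
    opNorm (scaled W out.1) ≤ 3 * (1 + δ) := by
  rcases h with h | h
  · rw [scaled, if_pos h.1]; exact h.2
  · rw [scaled, if_neg h.1.not_ge]; exact h.2.1

theorem symBetween_scaled_symPart {a b γ : ℝ} {W : Mat d} :
    SymBetween a b (scaled (symPart W) γ) ↔ SymBetween a b (scaled W γ) := by
  rw [scaled_eq, scaled_eq, ← symPart_smul, symBetween_symPart]

/-- The pair `out = (γ, S)` is a correct answer of the approximate separation oracle for the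
set `learnSet Q.S` at the matrix `W`: rescaling `W` by `γ` makes it feasible up to the factor
`1 + δ`, and if `γ > 1` then `S` separates `W` from the set with margin `γ - 1`. -/
structure Method.Separates (Q : Method d) (W : Mat d) (out : ℝ × Mat d) : Prop where
  mem : out.2 ∈ Q.S
  sym : SymBetween (-(1 + Q.δ)) (1 + Q.δ) (scaled W out.1)
  op : opNorm (scaled W out.1) ≤ 3 * (1 + Q.δ)
  norm_le : 1 < out.1 → frobNorm out.2 ≤ 1
  margin : 1 < out.1 → ∀ X ∈ learnSet Q.S, out.1 - 1 ≤ frobInner out.2 (W - X)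

theorem Method.separates_separate {Q : Method d} (hδ : 0 ≤ Q.δ) {Ξ₁ Ξ₂ : Type*}
    {ext : Oracle d Ξ₁} {svec : Oracle d Ξ₂} {t : ℕ} {W : Mat d} (hW : W ∈ Q.S) {ξ₁ : Ξ₁}
    {ξ₂ : Ξ₂}
    (h₁ : ExtEvecGood (symPart W) Q.δ (ext (symPart W) Q.δ (Q.q t / 2) ξ₁))
    (h₂ : MaxSvecGood W Q.δ (svec W Q.δ (Q.q t / 2) ξ₂)) :
    Q.Separates W (Q.separate ext svec t W ξ₁ ξ₂) := by
  have hs := symBetween_scaled_symPart.1 h₁.symBetween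
  have ho := h₂.opNorm_le
  simp only [Method.separate]
  set o₁ := ext (symPart W) Q.δ (Q.q t / 2) ξ₁
  set o₂ := svec W Q.δ (Q.q t / 2) ξ₂
  split_ifs with hle
  · refine ⟨proj_mem _ _, hs, (opNorm_scaled_anti W hle).trans ho, fun h1 => ?_, fun h1 X hX => ?_⟩
    all_goals obtain h | ⟨-, -, hn, hm⟩ := h₁
    · exact absurd h.1 (not_le.2 h1)
    · exact (frobNorm_proj_le _ _).trans hn
    · exact absurd h.1 (not_le.2 h1)
    · rw [frobInner_proj_left _ _ (sub_mem hW hX.2.2)]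
      -- shifting `X` by the skew part of `W` does not change its symmetric part
      have hsym : SymBetween (-1) 1 (symPart W - W + X) := by
        have := hX.1
        rw [symBetween_iff] at this ⊢
        simpa [inner_add_right, inner_sub_right, inner_act_symPart] using this
      have := hm _ hsym
      rwa [show symPart W - (symPart W - W + X) = W - X by abel] at this
  · have hle := (not_le.1 hle).le
    refine ⟨proj_mem _ _, hs.scaled_mono (by linarith) hle, ho, fun h1 => ?_, fun h1 X hX => ?_⟩
    all_goals obtain h | ⟨-, -, hn, hm⟩ := h₂
    · exact absurd h.1 (not_le.2 h1)
    · exact (frobNorm_proj_le _ _).trans hn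
    · exact absurd h.1 (not_le.2 h1)
    · rw [frobInner_proj_left _ _ (sub_mem hW hX.2.2)]
      exact hm X hX.2.1

/-! ### Regret of a round of online learning -/

/-- The invariant of the Jacobian approximation part of a state. -/
structure State.Valid (Q : Method d) (st : State d) : Prop where
  W_mem : st.W ∈ Q.S
  B_eq : st.B = Q.approx st.W st.γ
  separates : Q.Separates st.W (st.γ, st.S)

theorem Method.approx_eq (Q : Method d) (W : Mat d) (γ : ℝ) :
    Q.approx W γ = Q.L₁ • scaled W γ + (Q.L₁ + Q.μ) • (1 : Mat d) := rfl

theorem Method.grad_mem (Q : Method d) (st : State d) : Q.grad st ∈ Q.S :=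
  Q.S.smul_mem _ (proj_mem _ _)

theorem State.Valid.surrogateGrad_mem {Q : Method d} {st : State d} (hv : st.Valid Q) :
    Q.surrogateGrad st ∈ Q.S := by
  rw [Method.surrogateGrad]
  split_ifs
  · exact Q.grad_mem st
  · exact Q.S.add_mem (Q.grad_mem st) (Q.S.smul_mem _ hv.separates.mem)

theorem State.Valid.nextW_mem {Q : Method d} {st : State d} (hv : st.Valid Q) :
    Q.nextW st ∈ Q.S :=
  Q.S.smul_mem _ (Q.S.sub_mem hv.W_mem (Q.S.smul_mem _ hv.surrogateGrad_mem))

/-- The surrogate gradient majorizes the regret at the rescaled matrix. -/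
theorem State.Valid.frobInner_grad_le {Q : Method d} {st : State d} (hv : st.Valid Q)
    {X : Mat d} (hX : X ∈ learnSet Q.S) :
    frobInner (Q.grad st) (scaled st.W st.γ - X)
      ≤ frobInner (Q.surrogateGrad st) (st.W - X) := by
  rw [Method.surrogateGrad, scaled]
  split_ifs with hγ
  · exact le_rfl
  have hγ : 1 < st.γ := not_le.1 hγ
  set m := max 0 (-(1 / st.γ) * frobInner (Q.grad st) st.W)
  have hm0 : 0 ≤ m := le_max_left _ _
  have hm1 : -(1 / st.γ) * frobInner (Q.grad st) st.W ≤ m := le_max_right _ _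
  have h1 := mul_le_mul_of_nonneg_left (hv.separates.margin hγ X hX) hm0
  rw [frobInner_add_left, frobInner_smul_left, frobInner_sub_right, frobInner_smul_right,
    frobInner_sub_right (Q.grad st)]
  have h2 := mul_le_mul_of_nonneg_left hm1 (sub_pos.2 hγ).le
  have h3 : 1 / st.γ * st.γ = 1 := by field_simp
  generalize 1 / st.γ = c at *
  dsimp only at h1
  linear_combination h1 + h2 + frobInner (Q.grad st) st.W * h3

/-- The Jacobian at the solution, in the coordinates of online learning. -/
noncomputable def Method.comparator (Q : Method d) (zs : Vec d) : Mat d :=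
  (1 / Q.L₁) • (jacobian Q.F zs - (Q.L₁ + Q.μ) • (1 : Mat d))

namespace Method.Admissible

variable {Q : Method d} {zs : Vec d} {L₂ : ℝ} (h : Q.Admissible zs L₂)
include h

theorem comparator_mem {B : Mat d} (hB : B ∈ feasible Q.μ Q.L₁ Q.S) :
    (1 / Q.L₁) • (B - (Q.L₁ + Q.μ) • (1 : Mat d)) ∈ learnSet Q.S := by
  obtain ⟨hs, ho, hm⟩ := hB
  have hL := h.L₁_pos
  have hμ := h.μ_pos
  have hμL := h.μ_le
  refine ⟨?_, ?_, Q.S.smul_mem _ (Q.S.sub_mem hm (Q.S.smul_mem _ h.one_mem))⟩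
  · rw [symBetween_iff] at hs ⊢
    simp only [act_smul, act_sub, act_one, smul_apply, sub_apply, inner_smul_right,
      inner_sub_right, one_apply_eq_self, real_inner_self_eq_norm_sq]
    refine ⟨fun x => ?_, fun x => ?_⟩
    · rw [div_mul_eq_mul_div, le_div_iff₀ hL]; linarith [hs.1 x]
    · rw [div_mul_eq_mul_div, div_le_iff₀ hL]
      nlinarith [hs.2 x, mul_nonneg hL.le (sq_nonneg ‖x‖), mul_nonneg hμ.le (sq_nonneg ‖x‖)]
  · rw [opNorm_smul, abs_of_pos (by positivity), div_mul_eq_mul_div, div_le_iff₀ hL]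
    have h1 := opNorm_sub_le B ((Q.L₁ + Q.μ) • (1 : Mat d))
    rw [opNorm_smul, abs_of_pos (by positivity)] at h1
    nlinarith [opNorm_one_le (d := d), opNorm_nonneg (1 : Mat d)]

theorem jacobian_mem : jacobian Q.F zs ∈ feasible Q.μ Q.L₁ Q.S := by
  refine ⟨symBetween_iff.2 ⟨h.inner_jacobian_ge zs, fun x => ?_⟩, h.opNorm_jacobian_le zs,
    h.jac_mem⟩
  calc _ ≤ ‖x‖ * ‖act (jacobian Q.F zs) x‖ := real_inner_le_norm _ _
    _ ≤ ‖x‖ * (Q.L₁ * ‖x‖) := by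
      gcongr
      exact (norm_act_le _ _).trans
        (mul_le_mul_of_nonneg_right (h.opNorm_jacobian_le zs) (norm_nonneg _))
    _ = _ := by ring

theorem valid_init : Q.init.Valid Q := by
  obtain ⟨hs, ho, hm⟩ := h.comparator_mem h.B₀_mem
  have hδ := h.δ_pos
  have hsc : scaled Q.init.W (Q.init.γ, Q.init.S).1 = Q.init.W := if_pos le_rfl
  refine ⟨hm, ?_, Q.S.zero_mem, ?_, ?_, fun h1 => absurd h1 (lt_irrefl _),
    fun h1 => absurd h1 (lt_irrefl _)⟩
  · have hL := h.L₁_pos.ne'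
    simp [Method.approx, Method.init, smul_smul, hL]
  · rw [hsc]
    rw [symBetween_iff] at hs ⊢
    refine ⟨fun x => (mul_le_mul_of_nonneg_right ?_ (sq_nonneg _)).trans (hs.1 x),
      fun x => (hs.2 x).trans (mul_le_mul_of_nonneg_right ?_ (sq_nonneg _))⟩ <;> linarith
  · rw [hsc]
    exact ho.trans (by linarith)

variable {st : State d} (hv : st.Valid Q)
include hv

theorem opNorm_scaled_le : opNorm (scaled st.W st.γ) ≤ 4.5 :=
  hv.separates.op.trans (by linarith [h.δ_le])

theorem opNorm_B_le : opNorm st.B ≤ 6.5 * Q.L₁ := by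
  have hL := h.L₁_pos
  have hμ := h.μ_pos
  rw [hv.B_eq, Method.approx_eq]
  refine (opNorm_add_le _ _).trans ?_
  rw [opNorm_smul, opNorm_smul, abs_of_pos hL, abs_of_pos (by positivity)]
  have h1 := mul_le_mul_of_nonneg_left (h.opNorm_scaled_le hv) hL.le
  have h2 := mul_le_mul_of_nonneg_left (opNorm_one_le (d := d)) (add_pos hL hμ).le
  linarith [h.μ_le]

theorem inner_B_ge (x : Vec d) : Q.μ / 2 * ‖x‖ ^ 2 ≤ inner ℝ x (act st.B x) := by
  have h1 := mul_le_mul_of_nonneg_left ((symBetween_iff.1 hv.separates.sym).1 x) h.L₁_pos.le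
  rw [hv.B_eq, Method.approx_eq]
  simp only [act_add, act_smul, act_one, add_apply, smul_apply, inner_add_right, inner_smul_right,
    one_apply_eq_self, real_inner_self_eq_norm_sq]
  have h2 := h.L₁_mul_δ
  linear_combination h1 + ‖x‖ ^ 2 * h2

theorem frobNorm_surrogateGrad_le :
    frobNorm (Q.surrogateGrad st)
      ≤ 11 / Q.L₁ * √(loss (Q.F (Q.ztilde st) - Q.F st.z) (Q.ztilde st - st.z) st.B) := by
  have hL := h.L₁_pos
  set u := Q.F (Q.ztilde st) - Q.F st.z
  set s := Q.ztilde st - st.z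
  have h0 := Real.sqrt_nonneg (loss u s st.B)
  have hg : frobNorm (Q.grad st) ≤ 2 / Q.L₁ * √(loss u s st.B) := by
    rw [Method.grad, frobNorm_smul, abs_of_pos (by positivity)]
    calc _ ≤ 1 / Q.L₁ * (2 * √(loss u s st.B)) := by
          gcongr
          exact (frobNorm_proj_le _ _).trans (frobNorm_lossGrad_le _ _ _)
      _ = _ := by ring
  rw [Method.surrogateGrad]
  split_ifs with hγ
  · refine hg.trans (mul_le_mul_of_nonneg_right ?_ h0)
    gcongr
    norm_num
  have hγ1 : 1 < st.γ := not_le.1 hγ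
  refine (frobNorm_add_le _ _).trans ?_
  have hm : max 0 (-(1 / st.γ) * frobInner (Q.grad st) st.W) ≤ 9 / Q.L₁ * √(loss u s st.B) := by
    refine max_le (by positivity) ?_
    have hsW : scaled st.W st.γ = (1 / st.γ) • st.W := if_neg hγ
    have h1 := abs_frobInner_lossGrad_le u s st.B (scaled st.W st.γ)
    have h2 := h.opNorm_scaled_le hv
    rw [neg_mul, ← frobInner_smul_right, ← hsW, Method.grad, frobInner_smul_left,
      frobInner_proj_left _ _ (by rw [hsW]; exact Q.S.smul_mem _ hv.W_mem)]
    calc _ = 1 / Q.L₁ * -(frobInner (lossGrad u s st.B) (scaled st.W st.γ)) := by ring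
      _ ≤ 1 / Q.L₁ * (2 * √(loss u s st.B) * 4.5) := by
        gcongr
        exact ((neg_le_abs _).trans h1).trans (by gcongr)
      _ = _ := by ring
  rw [frobNorm_smul, abs_of_nonneg (le_max_left _ _)]
  have h3 := mul_le_mul hm (hv.separates.norm_le hγ1) (frobNorm_nonneg _) (by positivity)
  calc _ ≤ 2 / Q.L₁ * √(loss u s st.B) + 9 / Q.L₁ * √(loss u s st.B) * 1 := add_le_add hg h3
    _ = _ := by ring

/-- One round of online learning: the loss at the current approximation is controlled by the
decrease of the squared distance to the comparator and by the loss of the comparator. -/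
theorem loss_le :
    loss (Q.F (Q.ztilde st) - Q.F st.z) (Q.ztilde st - st.z) st.B
      ≤ 121 * Q.L₁ ^ 2 * (frobNorm (st.W - Q.comparator zs) ^ 2
          - frobNorm (Q.nextW st - Q.comparator zs) ^ 2)
        + 2 * loss (Q.F (Q.ztilde st) - Q.F st.z) (Q.ztilde st - st.z) (jacobian Q.F zs) := by
  have hL := h.L₁_pos
  have hX : Q.comparator zs ∈ learnSet Q.S := h.comparator_mem h.jacobian_mem
  have hn := h.frobNorm_surrogateGrad_le hv
  have hi := hv.frobInner_grad_le hX
  have hXs : jacobian Q.F zs = Q.L₁ • Q.comparator zs + (Q.L₁ + Q.μ) • (1 : Mat d) := by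
    simp [Method.comparator, smul_smul, hL.ne']
  have hBX : st.B - jacobian Q.F zs = Q.L₁ • (scaled st.W st.γ - Q.comparator zs) := by
    rw [hXs, hv.B_eq, Method.approx_eq, smul_sub]; abel
  have hsc : scaled st.W st.γ ∈ Q.S := by
    rw [scaled_eq]; exact Q.S.smul_mem _ hv.W_mem
  have hc := loss_sub_loss_le (Q.F (Q.ztilde st) - Q.F st.z) (Q.ztilde st - st.z) st.B
    (jacobian Q.F zs)
  have hp := frobNorm_ball_proj_sub_le h.R_pos (Q.comparator zs)
    (st.W - Q.ρ • Q.surrogateGrad st) (h.ball _ hX)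
  rw [← Method.nextW] at hp
  have hg : frobInner (lossGrad (Q.F (Q.ztilde st) - Q.F st.z) (Q.ztilde st - st.z) st.B)
      (st.B - jacobian Q.F zs)
      = Q.L₁ ^ 2 * frobInner (Q.grad st) (scaled st.W st.γ - Q.comparator zs) := by
    rw [hBX, frobInner_smul_right, Method.grad, frobInner_smul_left,
      frobInner_proj_left _ _ (Q.S.sub_mem hsc hX.2.2)]
    field_simp
  rw [hg] at hc
  set a := loss (Q.F (Q.ztilde st) - Q.F st.z) (Q.ztilde st - st.z) st.B with ha
  set b := loss (Q.F (Q.ztilde st) - Q.F st.z) (Q.ztilde st - st.z) (jacobian Q.F zs)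
  have ha0 : 0 ≤ a := loss_nonneg _ _ _
  have hsq : frobNorm (Q.nextW st - Q.comparator zs) ^ 2
      ≤ frobNorm (st.W - Q.comparator zs) ^ 2
        - 2 * Q.ρ * frobInner (Q.surrogateGrad st) (st.W - Q.comparator zs)
        + Q.ρ ^ 2 * frobNorm (Q.surrogateGrad st) ^ 2 := by
    refine (pow_le_pow_left₀ (frobNorm_nonneg _) hp 2).trans_eq ?_
    rw [show st.W - Q.ρ • Q.surrogateGrad st - Q.comparator zs
      = (st.W - Q.comparator zs) - Q.ρ • Q.surrogateGrad st by abel]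
    simp only [frobNorm_eq, ← inner_vec, map_sub (vec d) (st.W - Q.comparator zs), map_smul,
      norm_sub_sq_real, norm_smul, inner_smul_right, mul_pow, Real.norm_eq_abs, sq_abs,
      real_inner_comm (vec d (Q.surrogateGrad st))]
    ring
  have hn2 : frobNorm (Q.surrogateGrad st) ^ 2 * Q.L₁ ^ 2 ≤ 121 * a := by
    have h5 := pow_le_pow_left₀ (frobNorm_nonneg _) hn 2
    rw [mul_pow, Real.sq_sqrt ha0, div_pow] at h5
    calc _ ≤ 11 ^ 2 / Q.L₁ ^ 2 * a * Q.L₁ ^ 2 := by gcongr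
      _ = _ := by field_simp; ring
  rw [h.ρ_eq] at hsq
  have h6 := mul_le_mul_of_nonneg_left hsq (by positivity : 0 ≤ 121 * Q.L₁ ^ 2)
  have h7 := mul_le_mul_of_nonneg_left hi (by positivity : 0 ≤ 2 * Q.L₁ ^ 2)
  linear_combination 2 * hc + h6 + h7 + 1 / 121 * hn2

end Method.Admissible

/-! ### The proximal extragradient step -/

/-- The descent inequality of an inexact proximal extragradient step. With the residual
`e = ẑ - z + η f`, the new point is `ẑ - e / (1 + 2 η μ)`. -/
theorem extragradient_step {E : Type*} [NormedAddCommGroup E] [InnerProductSpace ℝ E]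
    {z zh f zs : E} {η μ α : ℝ} (hη : 0 < η) (hμ : 0 < μ) (hα0 : 0 ≤ α) (hα1 : α ≤ 1)
    (hf : μ * ‖zh - zs‖ ^ 2 ≤ inner ℝ f (zh - zs))
    (he : ‖zh - z + η • f‖ ≤ α * √(1 + η * μ) * ‖zh - z‖) :
    (1 + 2 * η * μ) * ‖(1 / (1 + 2 * η * μ)) • (z - η • f)
        + (1 - 1 / (1 + 2 * η * μ)) • zh - zs‖ ^ 2 + (1 - α) * ‖zh - z‖ ^ 2
      ≤ ‖z - zs‖ ^ 2 := by
  set e := zh - z + η • f with he_def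
  set a := zh - zs
  set b := zh - z
  have hημ : 0 < η * μ := by positivity
  set c := 1 + 2 * η * μ with hc
  have hc1 : 1 + η * μ ≤ c := by rw [hc]; linarith
  have hc0 : 0 < c := by linarith
  have h1 : (1 / c) • (z - η • f) + (1 - 1 / c) • zh - zs = a - (1 / c) • e := by
    rw [he_def]; module
  have h2 : z - zs = a - b := by simp [a, b]
  have h3 : η • f = e - b := by rw [he_def]; simp
  have h4 : η * inner ℝ f a = inner ℝ a e - inner ℝ a b := by
    rw [← real_inner_smul_left, h3, inner_sub_left, real_inner_comm, real_inner_comm b]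
  have h5 : ‖e‖ ^ 2 ≤ α * c * ‖b‖ ^ 2 := by
    refine (pow_le_pow_left₀ (norm_nonneg _) he 2).trans ?_
    rw [mul_pow, mul_pow, Real.sq_sqrt (by positivity)]
    gcongr
    nlinarith
  have h6 : ‖e‖ ^ 2 / c ≤ α * ‖b‖ ^ 2 := by
    rw [div_le_iff₀ hc0]; linarith
  have h7 := mul_le_mul_of_nonneg_left hf hη.le
  have h8 : c * ‖a - (1 / c) • e‖ ^ 2 = c * ‖a‖ ^ 2 - 2 * inner ℝ a e + ‖e‖ ^ 2 / c := by
    rw [norm_sub_sq_real, norm_smul, inner_smul_right, Real.norm_eq_abs,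
      abs_of_pos (by positivity)]
    field_simp
  rw [h1, h8, h2, norm_sub_sq_real a b, hc]
  linarith

/-! ### The line search -/

section Resolvent

variable {B : Mat d} {μ η : ℝ} (hμ : 0 < μ)
  (hB : ∀ x : Vec d, μ / 2 * ‖x‖ ^ 2 ≤ inner ℝ x (act B x))
include hB

theorem norm_le_norm_add_smul_act (hη : 0 ≤ η) (x : Vec d) :
    (1 + η * μ / 2) * ‖x‖ ≤ ‖x + η • act B x‖ := by
  rcases (norm_nonneg x).eq_or_lt with h0 | h0
  · rw [← h0, mul_zero]; exact norm_nonneg _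
  refine le_of_mul_le_mul_left ?_ h0
  calc ‖x‖ * ((1 + η * μ / 2) * ‖x‖) = ‖x‖ ^ 2 + η * (μ / 2 * ‖x‖ ^ 2) := by ring
    _ ≤ ‖x‖ ^ 2 + η * inner ℝ x (act B x) := by gcongr; exact hB x
    _ = inner ℝ x (x + η • act B x) := by
      rw [inner_add_right, inner_smul_right, real_inner_self_eq_norm_sq]
    _ ≤ _ := real_inner_le_norm _ _

include hμ

theorem exists_add_smul_act_eq (hη : 0 ≤ η) (f : Vec d) : ∃ x : Vec d, x + η • act B x = f := by
  have hinj : Function.Injective (1 + η • act B : Vec d →L[ℝ] Vec d).toLinearMap := by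
    rw [injective_iff_map_eq_zero]
    intro x hx
    have h1 := norm_le_norm_add_smul_act hB hη x
    have hx : x + η • act B x = 0 := hx
    rw [hx, norm_zero] at h1
    have : 0 < 1 + η * μ / 2 := by positivity
    exact norm_le_zero_iff.1 (nonpos_of_mul_nonpos_right h1 this)
  exact LinearMap.injective_iff_surjective.1 hinj f

/-- The norm of the resolvent `(I + η B)⁻¹ g` is antitone in `η`. -/
theorem norm_resolvent_anti {η' : ℝ} (hη : 0 < η) (hηη' : η ≤ η') {x y : Vec d}
    (hxy : x + η • act B x = y + η' • act B y) : ‖y‖ ≤ ‖x‖ := by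
  obtain ⟨w, hw⟩ := exists_add_smul_act_eq hμ hB hη.le y
  have hr : 1 ≤ η' / η := (one_le_div hη).2 hηη'
  have hrη : η' / η * η = η' := by field_simp
  have hwy : ‖w‖ ≤ ‖y‖ := by
    have h1 := norm_le_norm_add_smul_act hB hη.le w
    rw [hw] at h1
    have : 0 ≤ η * μ / 2 * ‖w‖ := by positivity
    linarith
  -- `x = r y - (r - 1) w` with `r = η' / η`, since both sides have the same image
  have hx : x = (η' / η) • y - (η' / η - 1) • w := by
    rw [← sub_eq_zero]
    set D := x - ((η' / η) • y - (η' / η - 1) • w) with hD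
    have h1 := norm_le_norm_add_smul_act hB hη.le D
    have h2 : D + η • act B D = (x + η • act B x) - (η' / η) • y - (η' / η * η) • act B y
        + (η' / η - 1) • (w + η • act B w) := by
      rw [hD]; simp only [map_sub, map_smul]; module
    rw [h2, hxy, hw, hrη, show y + η' • act B y - (η' / η) • y - η' • act B y
      + (η' / η - 1) • y = 0 by module, norm_zero] at h1
    have : 0 < 1 + η * μ / 2 := by positivity
    exact norm_le_zero_iff.1 (nonpos_of_mul_nonpos_right h1 this)
  have h3 : ‖(η' / η) • y‖ - ‖(η' / η - 1) • w‖ ≤ ‖x‖ := by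
    rw [hx]; exact norm_sub_norm_le _ _
  rw [norm_smul, norm_smul, Real.norm_eq_abs, Real.norm_eq_abs, abs_of_nonneg (by linarith),
    abs_of_nonneg (by linarith)] at h3
  have := mul_le_mul_of_nonneg_left hwy (sub_nonneg.2 hr)
  linarith

/-- An inexact solution `s` of `(I + η B) s = -η f` is close to the exact one. -/
theorem norm_sub_le_of_inexact {α : ℝ} (hη : 0 ≤ η) {s x f : Vec d}
    (hs : ‖s + η • act B s + η • f‖ ≤ α * √(1 + η * μ) * ‖s‖) (hx : x + η • act B x = -f) :
    ‖s - η • x‖ ≤ α * ‖s‖ := by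
  have h1 := norm_le_norm_add_smul_act hB hη (s - η • x)
  have h2 : s - η • x + η • act B (s - η • x) = s + η • act B s + η • f := by
    have : f = -(x + η • act B x) := by rw [hx, neg_neg]
    rw [this]; simp only [map_sub, map_smul]; module
  rw [h2] at h1
  have h3 : √(1 + η * μ) ≤ 1 + η * μ / 2 := by
    rw [Real.sqrt_le_left (by positivity)]
    nlinarith [sq_nonneg (η * μ)]
  have h4 : 0 < √(1 + η * μ) := Real.sqrt_pos.2 (by positivity)
  refine le_of_mul_le_mul_left ?_ h4
  have h5 := mul_le_mul_of_nonneg_right h3 (norm_nonneg (s - η • x))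
  linarith

/-- Increasing the step size by the factor `1 / β` increases the length of the inexact solution
by a bounded factor. -/
theorem norm_inexact_le {α β η' : ℝ} (hη : 0 < η) (hβ0 : 0 < β)
    (hβ1 : β ≤ 1) (hηη' : η = β * η') {s s' f : Vec d}
    (hs : ‖s + η • act B s + η • f‖ ≤ α * √(1 + η * μ) * ‖s‖)
    (hs' : ‖s' + η' • act B s' + η' • f‖ ≤ α * √(1 + η' * μ) * ‖s'‖) :
    (1 - α) * β * ‖s'‖ ≤ (1 + α) * ‖s‖ := by
  have hη' : 0 < η' := by
    by_contra hn
    exact absurd hη (not_lt.2 (hηη' ▸ mul_nonpos_of_nonneg_of_nonpos hβ0.le (not_lt.1 hn)))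
  have hle : η ≤ η' := hηη' ▸ mul_le_of_le_one_left hη'.le hβ1
  obtain ⟨x, hx⟩ := exists_add_smul_act_eq hμ hB hη.le (-f)
  obtain ⟨y, hy⟩ := exists_add_smul_act_eq hμ hB hη'.le (-f)
  have h1 := norm_sub_le_of_inexact hμ hB hη.le hs hx
  have h2 := norm_sub_le_of_inexact hμ hB hη'.le hs' hy
  have h3 := norm_resolvent_anti hμ hB hη hle (hx.trans hy.symm)
  have h4 : η * ‖x‖ ≤ (1 + α) * ‖s‖ := by
    have := norm_sub_norm_le (η • x) s
    rw [norm_smul, Real.norm_eq_abs, abs_of_pos hη, norm_sub_rev] at this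
    linarith
  have h5 : (1 - α) * ‖s'‖ ≤ η' * ‖y‖ := by
    have := norm_sub_norm_le s' (η' • y)
    rw [norm_smul, Real.norm_eq_abs, abs_of_pos hη'] at this
    linarith
  calc (1 - α) * β * ‖s'‖ = β * ((1 - α) * ‖s'‖) := by ring
    _ ≤ β * (η' * ‖y‖) := by gcongr
    _ = η * ‖y‖ := by rw [hηη']; ring
    _ ≤ η * ‖x‖ := by gcongr
    _ ≤ _ := h4

end Resolvent

namespace Method.Admissible

variable {Q : Method d} {zs : Vec d} {L₂ : ℝ} (h : Q.Admissible zs L₂)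
include h

theorem norm_trial_le {B : Mat d} (hB : ∀ x : Vec d, Q.μ / 2 * ‖x‖ ^ 2 ≤ inner ℝ x (act B x))
    {η : ℝ} (hη : 0 < η) (z : Vec d) :
    ‖(Q.trial z B η - z) + η • act B (Q.trial z B η - z) + η • Q.F z‖
      ≤ Q.α₁ * √(1 + η * Q.μ) * ‖Q.trial z B η - z‖ := by
  have hμ := h.μ_pos
  have hpos : (symPart (1 + η • B)).PosDef := posDef_symPart fun x hx => by
    have h1 : 0 < ‖x‖ := norm_pos_iff.2 hx
    have h2 := hB x
    have h3 : 0 < inner ℝ x (act B x) := lt_of_lt_of_le (by positivity) h2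
    simp only [act_add, act_one, act_smul, add_apply, one_apply_eq_self, smul_apply,
      inner_add_right, inner_smul_right, real_inner_self_eq_norm_sq]
    positivity
  have hτ : 0 < Q.α₁ * √(1 + η * Q.μ) :=
    mul_pos h.α₁_mem.1 (Real.sqrt_pos.2 (by positivity))
  have := h.solver (1 + η • B) (-(η • Q.F z)) _ hpos hτ
  simpa [Method.trial] using this

theorem accepts_of_le {B : Mat d} (hB : ∀ x : Vec d, Q.μ / 2 * ‖x‖ ^ 2 ≤ inner ℝ x (act B x))
    {η : ℝ} (hη : 0 < η) (z : Vec d)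
    (hle : η * √(loss (Q.F (Q.trial z B η) - Q.F z) (Q.trial z B η - z) B)
      ≤ Q.α₂ * √(1 + η * Q.μ)) : Q.Accepts z B η := by
  have h1 := h.norm_trial_le hB hη z
  rw [Method.Accepts]
  set z' := Q.trial z B η
  set s := z' - z with hs
  have h2 : ‖(Q.F z' - Q.F z) - act B s‖ = √(loss (Q.F z' - Q.F z) s B) * ‖s‖ := by
    rw [sqrt_loss]
    rcases eq_or_ne ‖s‖ 0 with h0 | h0
    · have hz : z' = z := sub_eq_zero.1 (norm_eq_zero.1 h0)
      simp [hs, hz]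
    · field_simp
  have h3 : s + η • Q.F z' = (s + η • act B s + η • Q.F z)
      + η • ((Q.F z' - Q.F z) - act B s) := by module
  rw [h3]
  refine (norm_add_le _ _).trans ?_
  rw [norm_smul, Real.norm_eq_abs, abs_of_pos hη, h2]
  have h4 := mul_le_mul_of_nonneg_right hle (norm_nonneg s)
  linarith

variable {st : State d} (hv : st.Valid Q) (hσ : Q.α₂ * Q.β / (7.5 * Q.L₁) ≤ st.σ)

theorem minStep_pos : 0 < Q.α₂ * Q.β / (7.5 * Q.L₁) := by
  have := h.α₂_mem.1
  have := h.β_mem.1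
  have := h.L₁_pos
  positivity

include hσ in
theorem stepSize_pos : 0 < Q.stepSize st :=
  mul_pos (h.minStep_pos.trans_le hσ) (pow_pos h.β_mem.1 _)

include hv

theorem accepts_of_small {η : ℝ} (hη : 0 < η) (hle : η ≤ Q.α₂ / (7.5 * Q.L₁)) :
    Q.Accepts st.z st.B η := by
  have hL := h.L₁_pos
  have hμ := h.μ_pos
  have hα := h.α₂_mem.1
  refine h.accepts_of_le (h.inner_B_ge hv) hη _ ?_
  have h1 := h.sqrt_loss_le (h.opNorm_B_le hv) st.z (Q.trial st.z st.B η)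
  have h2 : 1 ≤ √(1 + η * Q.μ) := Real.one_le_sqrt.2 (by nlinarith)
  calc _ ≤ η * (7.5 * Q.L₁) := by gcongr
    _ ≤ Q.α₂ := by rwa [← le_div_iff₀ (by positivity)]
    _ ≤ _ := le_mul_of_one_le_right hα.le h2

include hσ

theorem accepts_stepSize : Q.Accepts st.z st.B (Q.stepSize st) := by
  have hL := h.L₁_pos
  have hα := h.α₂_mem.1
  have hσ0 : 0 < st.σ := h.minStep_pos.trans_le hσ
  have hne : {i : ℕ | Q.Accepts st.z st.B (st.σ * Q.β ^ i)}.Nonempty := by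
    obtain ⟨i, hi⟩ := exists_pow_lt_of_lt_one
      (show 0 < Q.α₂ / (7.5 * Q.L₁) / st.σ by positivity) h.β_mem.2
    refine ⟨i, h.accepts_of_small hv (mul_pos hσ0 (pow_pos h.β_mem.1 i)) ?_⟩
    rw [lt_div_iff₀ hσ0] at hi
    linarith
  exact Nat.sInf_mem hne

/-- If the line search backtracked, then the loss of the current approximation bounds the accepted
step size from below. -/
theorem lt_stepSize_mul_sqrt_loss (hn : Q.numBacktracks st ≠ 0) :
    Q.α₂ * Q.β < Q.stepSize st
      * √(loss (Q.F (Q.ztilde st) - Q.F st.z) (Q.ztilde st - st.z) st.B) := by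
  have hμ := h.μ_pos
  set η := st.σ * Q.β ^ (Q.numBacktracks st - 1) with hη_def
  have hη : 0 < η := mul_pos (h.minStep_pos.trans_le hσ) (pow_pos h.β_mem.1 _)
  have hs : Q.stepSize st = Q.β * η := by
    rw [Method.stepSize, hη_def, mul_left_comm, ← pow_succ', Nat.sub_add_cancel
      (Nat.one_le_iff_ne_zero.2 hn)]
  have hrej : ¬ Q.Accepts st.z st.B η :=
    Nat.notMem_of_lt_sInf (s := {i : ℕ | Q.Accepts st.z st.B (st.σ * Q.β ^ i)})
      (Nat.sub_lt (Nat.pos_of_ne_zero hn) one_pos)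
  have h1 := lt_of_not_ge fun hle => hrej (h.accepts_of_le (h.inner_B_ge hv) hη _ hle)
  have h2 : 1 ≤ √(1 + η * Q.μ) := Real.one_le_sqrt.2 (by nlinarith)
  have h3 : Q.α₂ ≤ Q.α₂ * √(1 + η * Q.μ) := le_mul_of_one_le_right h.α₂_mem.1.le h2
  rw [hs, mul_comm Q.α₂, mul_assoc]
  exact mul_lt_mul_of_pos_left (h3.trans_lt h1) h.β_mem.1

theorem minStep_le_stepSize : Q.α₂ * Q.β / (7.5 * Q.L₁) ≤ Q.stepSize st := by
  by_cases hn : Q.numBacktracks st = 0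
  · simpa [Method.stepSize, hn] using hσ
  have h1 := h.lt_stepSize_mul_sqrt_loss hv hσ hn
  have h2 := mul_le_mul_of_nonneg_left (h.sqrt_loss_le (h.opNorm_B_le hv) st.z (Q.ztilde st))
    (h.stepSize_pos hσ).le
  rw [div_le_iff₀ (by linarith [h.L₁_pos])]
  linarith

theorem norm_ztilde_le (hn : Q.numBacktracks st ≠ 0) :
    (1 - Q.α₁) * Q.β * ‖Q.ztilde st - st.z‖ ≤ (1 + Q.α₁) * ‖Q.zhat st - st.z‖ := by
  have hη : 0 < st.σ * Q.β ^ (Q.numBacktracks st - 1) :=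
    mul_pos (h.minStep_pos.trans_le hσ) (pow_pos h.β_mem.1 _)
  have hs : Q.stepSize st = Q.β * (st.σ * Q.β ^ (Q.numBacktracks st - 1)) := by
    rw [Method.stepSize, mul_left_comm, ← pow_succ', Nat.sub_add_cancel
      (Nat.one_le_iff_ne_zero.2 hn)]
  exact norm_inexact_le h.μ_pos (h.inner_B_ge hv) (h.stepSize_pos hσ)
    h.β_mem.1 h.β_mem.2.le hs
    (h.norm_trial_le (h.inner_B_ge hv) (h.stepSize_pos hσ) _)
    (h.norm_trial_le (h.inner_B_ge hv) hη _)

theorem norm_nextPoint_le :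
    (1 + 2 * Q.stepSize st * Q.μ) * ‖Q.nextPoint st - zs‖ ^ 2
      + (1 - (Q.α₁ + Q.α₂)) * ‖Q.zhat st - st.z‖ ^ 2 ≤ ‖st.z - zs‖ ^ 2 := by
  have h1 := h.mono (Q.zhat st) zs
  rw [h.zero, sub_zero] at h1
  exact extragradient_step (h.stepSize_pos hσ) h.μ_pos
    (by linarith [h.α₁_mem.1, h.α₂_mem.1]) (by linarith [h.α₁_mem.2, h.α₂_mem.2]) h1
    (h.accepts_stepSize hv hσ)

end Method.Admissible

/-! ### Inequalities for real sequences -/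

theorem sum_le_of_contracting {r e : ℕ → ℝ} {β c : ℝ} (hβ : 0 ≤ β) (hr : ∀ k, 0 ≤ r k)
    (h0 : r 0 ≤ c + e 0) (hc : 0 ≤ c)
    (hs : ∀ k, r (k + 1) ≤ β * r k + e (k + 1)) (n : ℕ) :
    (1 - β) * ∑ j ∈ Finset.range n, r j ≤ c + ∑ j ∈ Finset.range n, e j := by
  cases n with
  | zero => simpa using hc
  | succ n =>
    have h1 : ∑ j ∈ Finset.range n, r (j + 1)
        ≤ β * ∑ j ∈ Finset.range n, r j + ∑ j ∈ Finset.range n, e (j + 1) := by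
      rw [Finset.mul_sum, ← Finset.sum_add_distrib]
      exact Finset.sum_le_sum fun j _ => hs j
    have h2 := mul_nonneg hβ (hr n)
    have h3 := Finset.sum_range_succ r n
    have h4 := Finset.sum_range_succ' r n
    have h5 := Finset.sum_range_succ' e n
    rw [h5, sub_mul, one_mul]
    nth_rewrite 1 [h4]
    rw [h3]
    linarith

/-- If the arithmetic mean of `r` is at most `m`, then the geometric mean of `1 + c / r` is at
least `1 + c / m`. -/
theorem pow_le_prod_one_add_div {r : ℕ → ℝ} {c m : ℝ} (hc : 0 < c) (hm : 0 < m)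
    (hr : ∀ k, 0 < r k) {n : ℕ} (hsum : ∑ j ∈ Finset.range n, r j ≤ n * m) :
    (1 + c / m) ^ n ≤ ∏ j ∈ Finset.range n, (1 + c / r j) := by
  -- the tangent line at `m` of the concave function `r ↦ r / (r + c)`
  have h1 : ∀ j, 1 + c / m ≤ (1 + c / r j) * Real.exp (c / (m * (m + c)) * (r j - m)) := by
    intro j
    have hj := hr j
    calc 1 + c / m ≤ (1 + c / r j) * (c / (m * (m + c)) * (r j - m) + 1) := by
          rw [← sub_nonneg]
          have : (1 + c / r j) * (c / (m * (m + c)) * (r j - m) + 1) - (1 + c / m)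
              = c * (r j - m) ^ 2 / (r j * m * (m + c)) := by field_simp; ring
          rw [this]; positivity
      _ ≤ _ := by gcongr; exact Real.add_one_le_exp _
  calc (1 + c / m) ^ n = ∏ _j ∈ Finset.range n, (1 + c / m) := by simp
    _ ≤ ∏ j ∈ Finset.range n, (1 + c / r j) * Real.exp (c / (m * (m + c)) * (r j - m)) :=
      Finset.prod_le_prod (fun _ _ => by positivity) fun j _ => h1 j
    _ = (∏ j ∈ Finset.range n, (1 + c / r j))
        * Real.exp (c / (m * (m + c)) * (∑ j ∈ Finset.range n, r j - n * m)) := by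
      rw [Finset.prod_mul_distrib, ← Real.exp_sum, ← Finset.mul_sum, Finset.sum_sub_distrib]
      simp
    _ ≤ (∏ j ∈ Finset.range n, (1 + c / r j)) * 1 := by
      refine mul_le_mul_of_nonneg_left ?_
        (Finset.prod_nonneg fun j _ => by have := hr j; positivity)
      rw [Real.exp_le_one_iff]
      exact mul_nonpos_of_nonneg_of_nonpos (by positivity) (by linarith)
    _ = _ := mul_one _

/-! ### Runs in which all oracle answers are correct -/

/-- The oracle answers in an iteration started at `st` are correct (nothing is required if no
oracle is called). -/
def Method.RoundGood (Q : Method d) {Ξ₁ Ξ₂ : Type*} (ext : Oracle d Ξ₁) (svec : Oracle d Ξ₂)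
    (st : State d) (ξ₁ : Ξ₁) (ξ₂ : Ξ₂) : Prop :=
  Q.numBacktracks st ≠ 0 →
    ExtEvecGood (symPart (Q.nextW st)) Q.δ
      (ext (symPart (Q.nextW st)) Q.δ (Q.q (st.t + 1) / 2) ξ₁) ∧
    MaxSvecGood (Q.nextW st) Q.δ (svec (Q.nextW st) Q.δ (Q.q (st.t + 1) / 2) ξ₂)

/-- A sequence of states that follows the method, in which the invariants of the Jacobian
approximation and of the trial step size hold throughout. How the answers of the matrix oracles
were obtained is irrelevant for it. -/
structure Method.GoodRun (Q : Method d) (st : ℕ → State d) : Prop where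
  init : st 0 = Q.init
  valid : ∀ k, (st k).Valid Q
  σ_ge : ∀ k, Q.α₂ * Q.β / (7.5 * Q.L₁) ≤ (st k).σ
  σ_succ : ∀ k, (st (k + 1)).σ = Q.stepSize (st k) / Q.β
  z_succ : ∀ k, (st (k + 1)).z = Q.nextPoint (st k)
  W_keep : ∀ k, Q.numBacktracks (st k) = 0 → (st (k + 1)).W = (st k).W
  W_next : ∀ k, Q.numBacktracks (st k) ≠ 0 → (st (k + 1)).W = Q.nextW (st k)

/-- The loss incurred in an iteration, which is `0` if the line search did not backtrack. -/
noncomputable def Method.roundLoss (Q : Method d) (st : State d) : ℝ :=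
  if Q.numBacktracks st = 0 then 0
  else loss (Q.F (Q.ztilde st) - Q.F st.z) (Q.ztilde st - st.z) st.B

theorem Method.roundLoss_nonneg (Q : Method d) (st : State d) : 0 ≤ Q.roundLoss st := by
  rw [Method.roundLoss]; split_ifs; exacts [le_rfl, loss_nonneg _ _ _]

/-- The guaranteed relative decrease `4 α₂ β μ / (15 L₁)` of the squared distance to the
solution. -/
noncomputable def Method.gain (Q : Method d) : ℝ := 4 * Q.α₂ * Q.β * Q.μ / (15 * Q.L₁)

/-- The potential whose decrease bounds the loss incurred in an iteration. It combines the
distance of online learning to the comparator with the distance of the iterate to the solution. -/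
noncomputable def Method.potential (Q : Method d) (zs : Vec d) (L₂ : ℝ) (st : State d) : ℝ :=
  121 * Q.L₁ ^ 2 * frobNorm (st.W - Q.comparator zs) ^ 2
    + L₂ ^ 2 * (2 / Q.gain + Q.constC) * ((1 + Q.gain) * ‖st.z - zs‖ ^ 2)

theorem Method.rate_nonneg (m : ℝ) (k : ℕ) : 0 ≤ Method.rate m k := by
  rw [Method.rate]; split_ifs <;> positivity

theorem Method.rate_mul_max_le {m : ℝ} (hm : 0 ≤ m) (k : ℕ) :
    Method.rate m k * max 7.5 √(k * m) ≤ k := by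
  have hk : (0 : ℝ) ≤ k := k.cast_nonneg
  rw [Method.rate]
  split_ifs with h
  · rw [h, mul_zero, Real.sqrt_zero, max_eq_left (by norm_num)]; linarith
  have hm : 0 < m := lt_of_le_of_ne hm (Ne.symm h)
  rcases max_choice (7.5 : ℝ) √(k * m) with h1 | h1 <;> rw [h1]
  · refine (mul_le_mul_of_nonneg_right (min_le_left _ _) (by norm_num)).trans ?_
    linarith
  · refine (mul_le_mul_of_nonneg_right (min_le_right _ _) (Real.sqrt_nonneg _)).trans_eq ?_
    rw [← Real.sqrt_mul (by positivity), show (k : ℝ) / m * (k * m) = k ^ 2 by field_simp,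
      Real.sqrt_sq hk]

theorem Method.GoodRun.inv_stepSize_succ {Q : Method d} {st : ℕ → State d} (hrun : Q.GoodRun st)
    (k : ℕ) (hk : Q.numBacktracks (st (k + 1)) = 0) :
    1 / Q.stepSize (st (k + 1)) = Q.β * (1 / Q.stepSize (st k)) := by
  have h1 : Q.stepSize (st (k + 1)) = Q.stepSize (st k) / Q.β := by
    rw [Method.stepSize, hk, pow_zero, mul_one, hrun.σ_succ]
  rw [h1, one_div_div, mul_one_div]

namespace Method.Admissible

variable {Q : Method d} {zs : Vec d} {L₂ : ℝ} (h : Q.Admissible zs L₂)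
include h

theorem goodRun_run {Ξ₁ Ξ₂ : Type*} {ext : Oracle d Ξ₁} {svec : Oracle d Ξ₂} {ξ₁ : ℕ → Ξ₁}
    {ξ₂ : ℕ → Ξ₂}
    (hgood : ∀ k, Q.RoundGood ext svec (Q.run ext svec ξ₁ ξ₂ k) (ξ₁ k) (ξ₂ k)) :
    Q.GoodRun (Q.run ext svec ξ₁ ξ₂) := by
  have key : ∀ k, (Q.run ext svec ξ₁ ξ₂ k).Valid Q ∧
      Q.α₂ * Q.β / (7.5 * Q.L₁) ≤ (Q.run ext svec ξ₁ ξ₂ k).σ := by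
    intro k
    induction k with
    | zero => exact ⟨h.valid_init, h.σ₀_ge⟩
    | succ k ih =>
      obtain ⟨hv, hσ⟩ := ih
      rw [Method.run]
      have h1 := hgood k
      set st := Q.run ext svec ξ₁ ξ₂ k
      have h2 : Q.α₂ * Q.β / (7.5 * Q.L₁) ≤ Q.stepSize st / Q.β :=
        (h.minStep_le_stepSize hv hσ).trans
          (le_div_self (h.stepSize_pos hσ).le h.β_mem.1 h.β_mem.2.le)
      rw [Method.step]
      split_ifs with hn
      · exact ⟨⟨hv.W_mem, hv.B_eq, hv.separates⟩, h2⟩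
      · have h3 := h1 hn
        exact ⟨⟨hv.nextW_mem, rfl, Method.separates_separate h.δ_pos.le hv.nextW_mem h3.1 h3.2⟩,
          h2⟩
  refine ⟨rfl, fun k => (key k).1, fun k => (key k).2, fun k => ?_, fun k => ?_, fun k hk => ?_,
    fun k hk => ?_⟩ <;> rw [Method.run, Method.step]
  · split_ifs <;> rfl
  · split_ifs <;> rfl
  · rw [if_pos hk]
  · rw [if_neg hk]

theorem gain_pos : 0 < Q.gain := by
  have := h.α₂_mem.1
  have := h.β_mem.1
  have := h.L₁_pos
  have := h.μ_pos
  unfold Method.gain; positivity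

theorem gain_le_one : Q.gain ≤ 1 := by
  have h1 := h.α₂_mem.1
  have h2 := h.β_mem.1
  have h3 := h.L₁_pos
  have h4 := h.μ_pos
  rw [Method.gain, div_le_one (by positivity)]
  have h5 : Q.α₂ * Q.β ≤ 1 / 2 * 1 :=
    mul_le_mul h.α₂_mem.2.le h.β_mem.2.le h2.le (by norm_num)
  have h6 : Q.α₂ * Q.β * Q.μ ≤ 1 / 2 * 1 * Q.L₁ := mul_le_mul h5 h.μ_le h4.le (by norm_num)
  linarith

theorem constC_pos : 0 < Q.constC := by
  have h1 := h.α₁_mem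
  have h2 := h.α₂_mem
  have h3 := h.β_mem.1
  have h4 : 0 < 1 - (Q.α₁ + Q.α₂) := by linarith [h1.2, h2.2]
  have h5 : 0 < 1 - Q.α₁ := by linarith [h1.2]
  have h6 := h1.1
  unfold Method.constC; positivity

theorem constM_eq :
    Q.L₁ ^ 2 * Q.constM L₂ zs = 121 * frobNorm (Q.B₀ - jacobian Q.F zs) ^ 2
      + L₂ ^ 2 * (2 / Q.gain + Q.constC + 2) * ‖Q.z₀ - zs‖ ^ 2 := by
  have := h.α₂_mem.1
  have := h.β_mem.1
  have := h.L₁_pos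
  have := h.μ_pos
  have h1 : 15 * Q.L₁ / (2 * Q.α₂ * Q.β * Q.μ) = 2 / Q.gain := by
    unfold Method.gain; field_simp; norm_num
  rw [Method.constM, h1]
  field_simp
  ring

theorem constM_nonneg : 0 ≤ Q.constM L₂ zs := by
  have h1 := h.constC_pos
  have h2 := h.gain_pos
  have h3 := h.L₁_pos
  have h4 : 0 ≤ Q.L₁ ^ 2 * Q.constM L₂ zs := by
    rw [h.constM_eq]; positivity
  exact nonneg_of_mul_nonneg_right h4 (by positivity)

theorem potential_nonneg (st : State d) : 0 ≤ Q.potential zs L₂ st := by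
  have hx := h.gain_pos
  have hC := h.constC_pos
  unfold Method.potential; positivity

section Step

variable {st : State d} (hv : st.Valid Q) (hσ : Q.α₂ * Q.β / (7.5 * Q.L₁) ≤ st.σ)
include hv hσ

theorem gain_le : Q.gain ≤ 2 * Q.stepSize st * Q.μ := by
  have h1 := h.minStep_le_stepSize hv hσ
  have h2 := h.L₁_pos
  have h3 := mul_le_mul_of_nonneg_left h1 (by linarith [h.μ_pos] : 0 ≤ 2 * Q.μ)
  calc Q.gain = 2 * Q.μ * (Q.α₂ * Q.β / (7.5 * Q.L₁)) := by
        unfold Method.gain; field_simp; ring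
    _ ≤ _ := by linarith

theorem sq_norm_nextPoint_le :
    (1 + 2 * Q.stepSize st * Q.μ) * ‖Q.nextPoint st - zs‖ ^ 2 ≤ ‖st.z - zs‖ ^ 2 := by
  have h1 := h.norm_nextPoint_le hv hσ
  have h2 : 0 ≤ 1 - (Q.α₁ + Q.α₂) := by linarith [h.α₁_mem.2, h.α₂_mem.2]
  have := mul_nonneg h2 (sq_nonneg ‖Q.zhat st - st.z‖)
  linarith

theorem one_add_gain_mul_le :
    (1 + Q.gain) * ‖Q.nextPoint st - zs‖ ^ 2 ≤ ‖st.z - zs‖ ^ 2 := by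
  refine le_trans ?_ (h.sq_norm_nextPoint_le hv hσ)
  gcongr
  exact h.gain_le hv hσ

theorem energy_le (hn : Q.numBacktracks st ≠ 0) :
    (1 + Q.gain) * ‖Q.nextPoint st - zs‖ ^ 2 + ‖Q.ztilde st - st.z‖ ^ 2 / (2 * Q.constC)
      ≤ ‖st.z - zs‖ ^ 2 := by
  have h1 := h.norm_nextPoint_le hv hσ
  have h2 := mul_le_mul_of_nonneg_right (h.gain_le hv hσ) (sq_nonneg ‖Q.nextPoint st - zs‖)
  have h3 := h.norm_ztilde_le hv hσ hn
  have a1 := h.α₁_mem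
  have a2 := h.α₂_mem
  have a3 := h.β_mem.1
  have a4 : 0 < 1 - (Q.α₁ + Q.α₂) := by linarith [a1.2, a2.2]
  have a5 : 0 < 1 - Q.α₁ := by linarith [a1.2]
  have a6 : 0 < 1 + Q.α₁ := by linarith [a1.1]
  have h4 : ‖Q.ztilde st - st.z‖ ^ 2 / (2 * Q.constC)
      = (1 - (Q.α₁ + Q.α₂))
        * (((1 - Q.α₁) * Q.β * ‖Q.ztilde st - st.z‖) ^ 2 / (1 + Q.α₁) ^ 2) := by
    unfold Method.constC; field_simp
  have h5 : ((1 - Q.α₁) * Q.β * ‖Q.ztilde st - st.z‖) ^ 2 / (1 + Q.α₁) ^ 2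
      ≤ ‖Q.zhat st - st.z‖ ^ 2 := by
    rw [div_le_iff₀ (by positivity), mul_comm (‖Q.zhat st - st.z‖ ^ 2), ← mul_pow]
    exact pow_le_pow_left₀ (by positivity) h3 2
  rw [h4]
  have h6 := mul_le_mul_of_nonneg_left h5 a4.le
  linarith

/-- The loss of the Jacobian at the solution is controlled by the decrease of the distance to the
solution. -/
theorem two_mul_loss_jacobian_le (hn : Q.numBacktracks st ≠ 0) :
    2 * loss (Q.F (Q.ztilde st) - Q.F st.z) (Q.ztilde st - st.z) (jacobian Q.F zs)
      ≤ L₂ ^ 2 * (2 / Q.gain + Q.constC)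
        * ((1 + Q.gain) * (‖st.z - zs‖ ^ 2 - ‖Q.nextPoint st - zs‖ ^ 2)) := by
  have h1 := h.loss_jacobian_le st.z (Q.ztilde st)
  have h2 := h.energy_le hv hσ hn
  have hx := h.gain_pos
  have hC := h.constC_pos
  set a := ‖st.z - zs‖
  set b := ‖Q.ztilde st - st.z‖
  set x := Q.gain
  set C := Q.constC
  -- the Cauchy-Schwarz inequality
  have h3 : 2 * (a + b / 2) ^ 2 ≤ (2 / x + C) * (x * a ^ 2 + b ^ 2 / (2 * C)) := by
    rw [← sub_nonneg]
    have : (2 / x + C) * (x * a ^ 2 + b ^ 2 / (2 * C)) - 2 * (a + b / 2) ^ 2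
        = (C * x * a - b) ^ 2 / (C * x) := by field_simp; ring
    rw [this]; positivity
  calc _ ≤ 2 * (L₂ ^ 2 * (a + b / 2) ^ 2) := by gcongr
    _ = L₂ ^ 2 * (2 * (a + b / 2) ^ 2) := by ring
    _ ≤ L₂ ^ 2 * ((2 / x + C) * (x * a ^ 2 + b ^ 2 / (2 * C))) := by gcongr
    _ ≤ L₂ ^ 2 * ((2 / x + C) * ((1 + x) * (a ^ 2 - ‖Q.nextPoint st - zs‖ ^ 2))) := by
      gcongr; linarith
    _ = _ := by ring

end Step

variable {st : ℕ → State d} (hrun : Q.GoodRun st)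
include hrun

theorem roundLoss_le_potential_sub (k : ℕ) :
    Q.roundLoss (st k) ≤ Q.potential zs L₂ (st k) - Q.potential zs L₂ (st (k + 1)) := by
  have hx := h.gain_pos
  have hC := h.constC_pos
  have hv := hrun.valid k
  have hσ := hrun.σ_ge k
  rw [Method.roundLoss, Method.potential, Method.potential, hrun.z_succ k]
  split_ifs with hn
  · rw [hrun.W_keep k hn]
    have h1 := h.one_add_gain_mul_le hv hσ
    have h2 := mul_nonneg hx.le (sq_nonneg ‖Q.nextPoint (st k) - zs‖)
    have h3 : 0 ≤ L₂ ^ 2 * (2 / Q.gain + Q.constC)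
        * ((1 + Q.gain) * (‖(st k).z - zs‖ ^ 2 - ‖Q.nextPoint (st k) - zs‖ ^ 2)) :=
      mul_nonneg (by positivity) (mul_nonneg (by positivity) (by linarith))
    linarith
  · rw [hrun.W_next k hn]
    have h1 := h.two_mul_loss_jacobian_le hv hσ hn
    have h2 := h.loss_le hv
    linarith

theorem sum_roundLoss_le (m n : ℕ) :
    ∑ j ∈ Finset.range n, Q.roundLoss (st (m + j)) ≤ Q.potential zs L₂ (st m) := by
  have h1 : ∀ n, ∑ j ∈ Finset.range n, Q.roundLoss (st (m + j))
      ≤ Q.potential zs L₂ (st m) - Q.potential zs L₂ (st (m + n)) := by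
    intro n
    induction n with
    | zero => simp
    | succ n ih =>
      rw [Finset.sum_range_succ]
      have := h.roundLoss_le_potential_sub hrun (m + n)
      rw [← add_assoc]
      linarith
  linarith [h1 n, h.potential_nonneg (st (m + n))]

theorem L₁_sq_mul_frobNorm_init :
    Q.L₁ ^ 2 * frobNorm ((st 0).W - Q.comparator zs) ^ 2
      = frobNorm (Q.B₀ - jacobian Q.F zs) ^ 2 := by
  have hL := h.L₁_pos
  have h1 : (st 0).W - Q.comparator zs = (1 / Q.L₁) • (Q.B₀ - jacobian Q.F zs) := by
    rw [hrun.init, Method.init, Method.comparator, ← smul_sub]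
    congr 1; abel
  rw [h1, frobNorm_smul, abs_of_pos (by positivity), mul_pow]
  field_simp

theorem sum_roundLoss_le_two_mul (n : ℕ) :
    ∑ j ∈ Finset.range n, Q.roundLoss (st j) ≤ 2 * (Q.L₁ ^ 2 * Q.constM L₂ zs) := by
  have h1 := h.sum_roundLoss_le hrun 0 n
  simp only [zero_add] at h1
  refine h1.trans ?_
  have hx := h.gain_pos
  have hx1 := h.gain_le_one
  have hC := h.constC_pos
  rw [Method.potential, mul_assoc 121, h.L₁_sq_mul_frobNorm_init hrun, h.constM_eq,
    show (st 0).z = Q.z₀ by rw [hrun.init]; rfl]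
  have h2 : (2 / Q.gain + Q.constC) * (1 + Q.gain) ≤ 2 * (2 / Q.gain + Q.constC + 2) := by
    have h3 : 0 < 2 / Q.gain := by positivity
    have h4 : (2 / Q.gain) * Q.gain = 2 := by field_simp
    nlinarith [mul_le_mul_of_nonneg_left hx1 hC.le]
  have h5 := mul_le_mul_of_nonneg_left h2
    (by positivity : 0 ≤ L₂ ^ 2 * ‖Q.z₀ - zs‖ ^ 2)
  linarith [sq_nonneg (frobNorm (Q.B₀ - jacobian Q.F zs))]

/-- If the initial trial step size is accepted, then the first decrease of the distance to the
solution improves the bound on the total loss. -/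
theorem sum_roundLoss_le_of_accept (h0 : Q.numBacktracks (st 0) = 0) (n : ℕ) :
    ∑ j ∈ Finset.range n, Q.roundLoss (st j) ≤ Q.L₁ ^ 2 * Q.constM L₂ zs := by
  have hM := h.constM_nonneg
  have hx := h.gain_pos
  have hC := h.constC_pos
  cases n with
  | zero => rw [Finset.sum_range_zero]; positivity
  | succ n =>
    have h1 := h.sum_roundLoss_le hrun 1 n
    have h2 : Q.roundLoss (st 0) = 0 := if_pos h0
    rw [Finset.sum_range_succ', h2, add_zero]
    simp only [add_comm 1] at h1
    refine h1.trans ?_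
    have h3 := h.one_add_gain_mul_le (hrun.valid 0) (hrun.σ_ge 0)
    rw [Method.potential, hrun.W_keep 0 h0, hrun.z_succ 0, mul_assoc 121,
      h.L₁_sq_mul_frobNorm_init hrun, h.constM_eq]
    rw [show (st 0).z = Q.z₀ by rw [hrun.init]; rfl] at h3
    have h4 := mul_le_mul_of_nonneg_left h3
      (by positivity : 0 ≤ L₂ ^ 2 * (2 / Q.gain + Q.constC))
    have h5 : 0 ≤ L₂ ^ 2 * ‖Q.z₀ - zs‖ ^ 2 := by positivity
    linarith

theorem inv_stepSize_pos (k : ℕ) : 0 < 1 / Q.stepSize (st k) :=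
  one_div_pos.2 (h.stepSize_pos (hrun.σ_ge k))

theorem inv_stepSize_le (k : ℕ) (hk : Q.numBacktracks (st k) ≠ 0) :
    1 / Q.stepSize (st k) ≤ √(Q.roundLoss (st k)) / (Q.α₂ * Q.β) := by
  have h1 := h.lt_stepSize_mul_sqrt_loss (hrun.valid k) (hrun.σ_ge k) hk
  have h2 := h.stepSize_pos (hrun.σ_ge k)
  rw [Method.roundLoss, if_neg hk, div_le_div_iff₀ h2 (mul_pos h.α₂_mem.1 h.β_mem.1)]
  linarith

theorem inv_stepSize_zero :
    1 / Q.stepSize (st 0) ≤ 7.5 * Q.L₁ / (Q.α₂ * Q.β) := by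
  have h1 := h.minStep_le_stepSize (hrun.valid 0) (hrun.σ_ge 0)
  have h2 := one_div_le_one_div_of_le h.minStep_pos h1
  rwa [one_div_div] at h2

theorem sum_inv_stepSize_le (n : ℕ) :
    (1 - Q.β) * ∑ j ∈ Finset.range n, 1 / Q.stepSize (st j)
      ≤ 2 * Q.L₁ / (Q.α₂ * Q.β) * max 7.5 √(n * Q.constM L₂ zs) := by
  have hM := h.constM_nonneg
  have hL := h.L₁_pos
  have hκ : 0 < Q.α₂ * Q.β := mul_pos h.α₂_mem.1 h.β_mem.1
  have hβ := h.β_mem.1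
  set M := Q.constM L₂ zs
  set e : ℕ → ℝ := fun j => √(Q.roundLoss (st j)) / (Q.α₂ * Q.β)
  have he : ∀ k, 0 ≤ e k := fun k => by positivity
  have hstep : ∀ k, 1 / Q.stepSize (st (k + 1)) ≤ Q.β * (1 / Q.stepSize (st k)) + e (k + 1) := by
    intro k
    by_cases hk : Q.numBacktracks (st (k + 1)) = 0
    · rw [hrun.inv_stepSize_succ k hk]; linarith [he (k + 1)]
    · have := mul_nonneg hβ.le (h.inv_stepSize_pos hrun k).le
      linarith [h.inv_stepSize_le hrun (k + 1) hk]
  have hsum : ∀ T, ∑ j ∈ Finset.range n, Q.roundLoss (st j) ≤ T →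
      ∑ j ∈ Finset.range n, e j ≤ √(n * T) / (Q.α₂ * Q.β) := by
    intro T hT
    rw [← Finset.sum_div]
    refine div_le_div_of_nonneg_right (Real.le_sqrt_of_sq_le ?_) hκ.le
    refine sq_sum_le_card_mul_sum_sq.trans ?_
    rw [Finset.card_range]
    gcongr
    simpa only [Real.sq_sqrt (Q.roundLoss_nonneg _)] using hT
  have hX0 := Real.sqrt_nonneg (n * M)
  have hmax1 := le_max_left (7.5 : ℝ) √(n * M)
  have hmax2 := le_max_right (7.5 : ℝ) √(n * M)
  by_cases h0 : Q.numBacktracks (st 0) = 0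
  · have h1 := sum_le_of_contracting hβ.le (fun k => (h.inv_stepSize_pos hrun k).le)
      ((h.inv_stepSize_zero hrun).trans (le_add_of_nonneg_right (he 0)))
      (by positivity) hstep n
    have h2 := hsum _ (h.sum_roundLoss_le_of_accept hrun h0 n)
    have h3 : √(n * (Q.L₁ ^ 2 * M)) = Q.L₁ * √(n * M) := by
      rw [show (n : ℝ) * (Q.L₁ ^ 2 * M) = Q.L₁ ^ 2 * (n * M) by ring,
        Real.sqrt_mul (by positivity), Real.sqrt_sq hL.le]
    rw [h3] at h2
    calc _ ≤ 7.5 * Q.L₁ / (Q.α₂ * Q.β) + Q.L₁ * √(n * M) / (Q.α₂ * Q.β) := by linarith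
      _ = Q.L₁ / (Q.α₂ * Q.β) * (7.5 + √(n * M)) := by ring
      _ ≤ Q.L₁ / (Q.α₂ * Q.β) * (2 * max 7.5 √(n * M)) := by gcongr; linarith
      _ = _ := by ring
  · have h1 := sum_le_of_contracting (c := 0) hβ.le
      (fun k => (h.inv_stepSize_pos hrun k).le)
      (by rw [zero_add]; exact h.inv_stepSize_le hrun 0 h0) le_rfl hstep n
    have h2 := hsum _ (h.sum_roundLoss_le_two_mul hrun n)
    have h3 : √(n * (2 * (Q.L₁ ^ 2 * M))) ≤ 2 * Q.L₁ * √(n * M) := by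
      rw [Real.sqrt_le_left (by positivity), mul_pow, Real.sq_sqrt (by positivity)]
      have : 0 ≤ Q.L₁ ^ 2 * (n * M) := by positivity
      linarith
    calc _ ≤ 2 * Q.L₁ * √(n * M) / (Q.α₂ * Q.β) := by
          rw [zero_add] at h1
          exact (h1.trans h2).trans (by gcongr)
      _ = 2 * Q.L₁ / (Q.α₂ * Q.β) * √(n * M) := by ring
      _ ≤ _ := by gcongr

/-! ### Convergence of good runs -/

theorem linear_convergence (k : ℕ) :
    ‖(st (k + 1)).z - zs‖ ^ 2
      ≤ (1 + 4 * Q.α₂ * Q.β * Q.μ / (15 * Q.L₁))⁻¹ * ‖(st k).z - zs‖ ^ 2 := by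
  have h1 := h.one_add_gain_mul_le (hrun.valid k) (hrun.σ_ge k)
  have h2 := h.gain_pos
  rw [hrun.z_succ k, ← Method.gain, ← div_eq_inv_mul, le_div_iff₀' (by positivity)]
  exact h1

theorem tendsto_inv_stepSize : Tendsto (fun k => 1 / Q.stepSize (st k)) atTop (𝓝 0) := by
  have hβ := h.β_mem
  set r : ℕ → ℝ := fun k => 1 / Q.stepSize (st k)
  have hr : ∀ k, 0 < r k := h.inv_stepSize_pos hrun
  set e : ℕ → ℝ := fun j => (√(Q.roundLoss (st j)) / (Q.α₂ * Q.β)) ^ 2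
  have hstep : ∀ k, r (k + 1) ^ 2 ≤ Q.β ^ 2 * r k ^ 2 + e (k + 1) := by
    intro k
    by_cases hk : Q.numBacktracks (st (k + 1)) = 0
    · have h1 : r (k + 1) = Q.β * r k := hrun.inv_stepSize_succ k hk
      rw [h1, mul_pow]
      exact le_add_of_nonneg_right (sq_nonneg _)
    · have h1 := pow_le_pow_left₀ (hr (k + 1)).le (h.inv_stepSize_le hrun (k + 1) hk) 2
      exact h1.trans (le_add_of_nonneg_left (by positivity))
  have hβ2 : 0 < 1 - Q.β ^ 2 := by nlinarith [hβ.1, hβ.2]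
  have h1 : ∀ n, ∑ j ∈ Finset.range n, r j ^ 2
      ≤ (r 0 ^ 2 + 2 * (Q.L₁ ^ 2 * Q.constM L₂ zs) / (Q.α₂ * Q.β) ^ 2) / (1 - Q.β ^ 2) := by
    intro n
    have h2 := sum_le_of_contracting (sq_nonneg Q.β) (fun k => sq_nonneg (r k))
      (le_add_of_nonneg_right (sq_nonneg _) : r 0 ^ 2 ≤ r 0 ^ 2 + e 0) (sq_nonneg _)
      hstep n
    have h3 : ∑ j ∈ Finset.range n, e j
        ≤ 2 * (Q.L₁ ^ 2 * Q.constM L₂ zs) / (Q.α₂ * Q.β) ^ 2 := by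
      have : ∀ j, e j = Q.roundLoss (st j) / (Q.α₂ * Q.β) ^ 2 := fun j => by
        simp only [e, div_pow, Real.sq_sqrt (Q.roundLoss_nonneg _)]
      simp only [this]
      rw [← Finset.sum_div]
      exact div_le_div_of_nonneg_right (h.sum_roundLoss_le_two_mul hrun n) (sq_nonneg _)
    rw [le_div_iff₀ hβ2]
    linarith
  have h2 := (summable_of_sum_range_le (fun k => sq_nonneg (r k)) h1).tendsto_atTop_zero
  have h3 := h2.sqrt
  simpa only [Real.sqrt_sq (hr _).le, Real.sqrt_zero] using h3

theorem superlinear_convergence :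
    Tendsto (fun k : ℕ => ‖(st (k + 1)).z - zs‖ ^ 2 / ‖(st k).z - zs‖ ^ 2) atTop (𝓝 0) := by
  have hμ := h.μ_pos
  have h1 := (h.tendsto_inv_stepSize hrun).div_const (2 * Q.μ)
  rw [zero_div] at h1
  refine squeeze_zero (fun k => by positivity) (fun k => ?_) h1
  have hη := h.stepSize_pos (hrun.σ_ge k)
  have h2 := h.sq_norm_nextPoint_le (hrun.valid k) (hrun.σ_ge k)
  rw [← hrun.z_succ] at h2
  refine div_le_of_le_mul₀ (by positivity) (by positivity) ?_
  rw [div_div, one_div, ← div_eq_inv_mul, le_div_iff₀' (by positivity)]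
  linarith [sq_nonneg ‖(st (k + 1)).z - zs‖]

theorem prod_mul_le (n : ℕ) :
    (∏ j ∈ Finset.range n, (1 + 2 * Q.μ / (1 / Q.stepSize (st j)))) * ‖(st n).z - zs‖ ^ 2
      ≤ ‖(st 0).z - zs‖ ^ 2 := by
  induction n with
  | zero => simp
  | succ n ih =>
    rw [Finset.prod_range_succ, mul_assoc]
    refine le_trans (mul_le_mul_of_nonneg_left ?_ ?_) ih
    · have := h.sq_norm_nextPoint_le (hrun.valid n) (hrun.σ_ge n)
      rw [hrun.z_succ, div_div_eq_mul_div, div_one]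
      linarith
    · have hμ := h.μ_pos
      exact Finset.prod_nonneg fun j _ => by have := h.inv_stepSize_pos hrun j; positivity

theorem explicit_convergence (k : ℕ) :
    ‖(st k).z - zs‖ ^ 2
      ≤ ((1 + (1 - Q.β) * Q.α₂ * Q.β * Q.μ / Q.L₁ * Method.rate (Q.constM L₂ zs) k) ^ k)⁻¹
        * ‖(st 0).z - zs‖ ^ 2 := by
  rcases Nat.eq_zero_or_pos k with rfl | hk
  · simp
  have hk' : (0 : ℝ) < k := Nat.cast_pos.2 hk
  have hM := h.constM_nonneg
  have hL := h.L₁_pos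
  have hμ := h.μ_pos
  have hβ := h.β_mem.1
  have hα := h.α₂_mem.1
  have hβ1 : 0 < 1 - Q.β := sub_pos.2 h.β_mem.2
  have hrate := Method.rate_nonneg (Q.constM L₂ zs) k
  set X := max 7.5 √(k * Q.constM L₂ zs) with hX_def
  have hX : 0 < X := lt_max_of_lt_left (by norm_num)
  set m := 2 * Q.L₁ / (Q.α₂ * Q.β) * X / ((1 - Q.β) * k) with hm_def
  have hm : 0 < m := by positivity
  have h1 : ∑ j ∈ Finset.range k, 1 / Q.stepSize (st j) ≤ k * m := by
    have h2 := h.sum_inv_stepSize_le hrun k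
    rw [← hX_def, ← le_div_iff₀' hβ1] at h2
    refine h2.trans_eq ?_
    rw [hm_def]
    field_simp
  have h3 := pow_le_prod_one_add_div (by positivity : 0 < 2 * Q.μ) hm
    (h.inv_stepSize_pos hrun) h1
  have h4 : (1 - Q.β) * Q.α₂ * Q.β * Q.μ / Q.L₁ * Method.rate (Q.constM L₂ zs) k
      ≤ 2 * Q.μ / m := by
    have h5 : Method.rate (Q.constM L₂ zs) k ≤ k / X :=
      (le_div_iff₀ hX).2 (Method.rate_mul_max_le hM k)
    calc _ ≤ (1 - Q.β) * Q.α₂ * Q.β * Q.μ / Q.L₁ * (k / X) := by gcongr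
      _ = _ := by rw [hm_def]; field_simp
  rw [← div_eq_inv_mul, le_div_iff₀' (by positivity)]
  refine le_trans ?_ (h.prod_mul_le hrun k)
  refine mul_le_mul_of_nonneg_right (le_trans ?_ h3) (sq_nonneg _)
  gcongr

end Method.Admissible

/-! ### Measurability of the method -/

instance : BorelSpace (Mat d) := inferInstanceAs (BorelSpace (Fin d → Fin d → ℝ))

instance : SecondCountableTopology (Mat d) :=
  inferInstanceAs (SecondCountableTopology (Fin d → Fin d → ℝ))

theorem _root_.Continuous.act {X : Type*} [TopologicalSpace X] {A : X → Mat d} {v : X → Vec d}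
    (hA : Continuous A) (hv : Continuous v) : Continuous fun x => act (A x) (v x) := by
  have : (fun x => QNPE.act (A x) (v x))
      = fun x => WithLp.toLp 2 ((A x).mulVec (WithLp.ofLp (v x))) := rfl
  rw [this]
  fun_prop

theorem continuous_act : Continuous (act : Mat d → Vec d →L[ℝ] Vec d) :=
  LinearMap.continuous_of_finiteDimensional
    (⟨⟨act, act_add⟩, act_smul⟩ : Mat d →ₗ[ℝ] Vec d →L[ℝ] Vec d)

theorem continuous_opNorm : Continuous (opNorm : Mat d → ℝ) := continuous_act.norm

theorem continuous_symPart : Continuous (symPart : Mat d → Mat d) := by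
  unfold symPart; fun_prop

theorem _root_.Continuous.frobInner {X : Type*} [TopologicalSpace X] {A B : X → Mat d}
    (hA : Continuous A) (hB : Continuous B) : Continuous fun x => frobInner (A x) (B x) := by
  unfold QNPE.frobInner; fun_prop

theorem _root_.Measurable.frobInner {X : Type*} [MeasurableSpace X] {A B : X → Mat d}
    (hA : Measurable A) (hB : Measurable B) : Measurable fun x => frobInner (A x) (B x) :=
  (continuous_fst.frobInner continuous_snd : Continuous fun p : Mat d × Mat d =>
    QNPE.frobInner p.1 p.2).measurable.comp (hA.prodMk hB)

theorem continuous_frobNorm : Continuous (frobNorm : Mat d → ℝ) :=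
  (continuous_id.frobInner continuous_id).sqrt

theorem continuous_proj (S : Submodule ℝ (Mat d)) : Continuous (proj S) :=
  (LinearMap.continuous_of_finiteDimensional (vec d).symm.toLinearMap).comp
    ((S.map (vec d).toLinearMap).starProjection.continuous.comp
      (LinearMap.continuous_of_finiteDimensional (vec d).toLinearMap))

theorem measurable_lossGrad :
    Measurable fun p : Vec d × Vec d × Mat d => lossGrad p.1 p.2.1 p.2.2 := by
  have h1 : (fun p : Vec d × Vec d × Mat d => lossGrad p.1 p.2.1 p.2.2)
      = fun p => (‖p.2.1‖ ^ 2)⁻¹ • (Matrix.of fun i j =>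
        -(2 * (p.1 - act p.2.2 p.2.1) i * p.2.1 j) : Mat d) := by
    funext p
    ext i j
    simp only [lossGrad, Matrix.of_apply, Matrix.smul_apply, smul_eq_mul]
    ring
  rw [h1]
  have h2 : Continuous fun p : Vec d × Vec d × Mat d => p.1 - act p.2.2 p.2.1 :=
    continuous_fst.sub (continuous_snd.snd.act continuous_snd.fst)
  have h3 : Continuous fun p : Vec d × Vec d × Mat d => (Matrix.of fun i j =>
      -(2 * (p.1 - act p.2.2 p.2.1) i * p.2.1 j) : Mat d) := by
    refine continuous_matrix fun i j => ?_
    have h4 := (EuclideanSpace.proj (𝕜 := ℝ) i).continuous.comp h2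
    have h5 := (EuclideanSpace.proj (𝕜 := ℝ) j).continuous.comp
      (continuous_snd.fst : Continuous fun p : Vec d × Vec d × Mat d => p.2.1)
    exact ((continuous_const.mul h4).mul h5).neg
  have h6 : Measurable fun p : Vec d × Vec d × Mat d => (‖p.2.1‖ ^ 2)⁻¹ :=
    ((measurable_snd.fst.norm).pow_const 2).inv
  exact h6.smul h3.measurable

theorem isClosed_symBetween (a b : ℝ) : IsClosed {A : Mat d | SymBetween a b A} := by
  have h1 : ∀ x : Vec d, Continuous fun A : Mat d => inner ℝ x (act A x) := fun x =>
    continuous_const.inner (continuous_id.act continuous_const)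
  simp only [symBetween_iff, Set.ofPred_and, Set.ofPred_forall]
  exact (isClosed_iInter fun x => isClosed_le continuous_const (h1 x)).inter
    (isClosed_iInter fun x => isClosed_le (h1 x) continuous_const)

theorem isClosed_margin (K : Set (Mat d)) :
    IsClosed {p : Mat d × ℝ × Mat d | ∀ X ∈ K, p.2.1 - 1 ≤ frobInner p.2.2 (p.1 - X)} := by
  simp only [Set.ofPred_forall]
  refine isClosed_iInter fun X => isClosed_iInter fun _ => isClosed_le (by fun_prop) ?_
  exact continuous_snd.snd.frobInner (continuous_fst.sub continuous_const)

theorem measurableSet_extEvecGood (δ : ℝ) :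
    MeasurableSet {p : Mat d × ℝ × Mat d | ExtEvecGood p.1 δ p.2} := by
  have hγ : Measurable fun p : Mat d × ℝ × Mat d => p.2.1 := by fun_prop
  have hs : Measurable fun p : Mat d × ℝ × Mat d => (1 / p.2.1) • p.1 :=
    (hγ.const_div 1).smul measurable_fst
  have hc := (isClosed_symBetween (d := d) (-(1 + δ)) (1 + δ)).measurableSet
  refine ((measurableSet_le hγ measurable_const).inter (measurable_fst hc)).union
    ((measurableSet_lt measurable_const hγ).inter ((hs hc).inter
      ((measurableSet_le (continuous_frobNorm.measurable.comp (by fun_prop)) measurable_const).inter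
        (isClosed_margin {X | SymBetween (-1) 1 X}).measurableSet)))

theorem measurableSet_maxSvecGood (δ : ℝ) :
    MeasurableSet {p : Mat d × ℝ × Mat d | MaxSvecGood p.1 δ p.2} := by
  have hγ : Measurable fun p : Mat d × ℝ × Mat d => p.2.1 := by fun_prop
  have hs : Measurable fun p : Mat d × ℝ × Mat d => (1 / p.2.1) • p.1 :=
    (hγ.const_div 1).smul measurable_fst
  have hc : MeasurableSet {A : Mat d | opNorm A ≤ 3 * (1 + δ)} :=
    measurableSet_le continuous_opNorm.measurable measurable_const
  refine ((measurableSet_le hγ measurable_const).inter (measurable_fst hc)).union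
    ((measurableSet_lt measurable_const hγ).inter ((hs hc).inter
      ((measurableSet_le (continuous_frobNorm.measurable.comp (by fun_prop)) measurable_const).inter
        (isClosed_margin {X | opNorm X ≤ 3}).measurableSet)))

/-- The components of a state. -/
def State.toProd (st : State d) : Vec d × ℝ × Mat d × ℕ × Mat d × ℝ × Mat d :=
  (st.z, st.σ, st.B, st.t, st.W, st.γ, st.S)

instance : MeasurableSpace (State d) := .comap State.toProd inferInstance

theorem State.measurable_toProd : Measurable (State.toProd (d := d)) := comap_measurable _

theorem State.measurable_iff {X : Type*} [MeasurableSpace X] {f : X → State d} :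
    Measurable f ↔ Measurable fun x => (f x).toProd := measurable_comap_iff

namespace State

theorem measurable_z : Measurable (State.z (d := d)) := measurable_toProd.fst
theorem measurable_σ : Measurable (State.σ (d := d)) := measurable_toProd.snd.fst
theorem measurable_B : Measurable (State.B (d := d)) := measurable_toProd.snd.snd.fst
theorem measurable_t : Measurable (State.t (d := d)) := measurable_toProd.snd.snd.snd.fst
theorem measurable_W : Measurable (State.W (d := d)) := measurable_toProd.snd.snd.snd.snd.fst
theorem measurable_γ : Measurable (State.γ (d := d)) := measurable_toProd.snd.snd.snd.snd.snd.fst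
theorem measurable_S : Measurable (State.S (d := d)) := measurable_toProd.snd.snd.snd.snd.snd.snd

end State

namespace Method

variable {Q : Method d}

section Iteration

variable (hF : Continuous Q.F)
  (hsolver : Measurable fun x : Mat d × Vec d × ℝ => Q.solver x.1 x.2.1 x.2.2)
include hF hsolver

theorem measurable_trial {X : Type*} [MeasurableSpace X] {z : X → Vec d} {B : X → Mat d}
    {η : X → ℝ} (hz : Measurable z) (hB : Measurable B) (hη : Measurable η) :
    Measurable fun x => Q.trial (z x) (B x) (η x) := by
  have hFz : Measurable fun x => Q.F (z x) := hF.measurable.comp hz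
  refine hz.add (hsolver.comp (g := fun x : Mat d × Vec d × ℝ => Q.solver x.1 x.2.1 x.2.2)
    (f := fun x => (1 + η x • B x, -(η x • Q.F (z x)), Q.α₁ * √(1 + η x * Q.μ))) ?_)
  exact (measurable_const.add (hη.smul hB)).prodMk
    ((hη.smul hFz).neg.prodMk (by fun_prop))

theorem measurableSet_accepts {X : Type*} [MeasurableSpace X] {z : X → Vec d} {B : X → Mat d}
    {η : X → ℝ} (hz : Measurable z) (hB : Measurable B) (hη : Measurable η) :
    MeasurableSet {x | Q.Accepts (z x) (B x) (η x)} := by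
  have h1 := measurable_trial hF hsolver hz hB hη
  have h2 := hF.measurable.comp h1
  refine measurableSet_le ((h1.sub hz).add (hη.smul h2)).norm ?_
  have h3 : Measurable fun x => ‖Q.trial (z x) (B x) (η x) - z x‖ := (h1.sub hz).norm
  exact Measurable.mul (by fun_prop) h3

theorem measurable_numBacktracks : Measurable Q.numBacktracks := by
  have hA : ∀ i : ℕ, MeasurableSet {st : State d | Q.Accepts st.z st.B (st.σ * Q.β ^ i)} :=
    fun i => measurableSet_accepts hF hsolver State.measurable_z State.measurable_B
      (State.measurable_σ.mul_const _)
  refine measurable_to_countable' fun n => ?_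
  have h1 : Q.numBacktracks ⁻¹' {n}
      = {st | (Q.Accepts st.z st.B (st.σ * Q.β ^ n) ∧
          ∀ m < n, ¬ Q.Accepts st.z st.B (st.σ * Q.β ^ m)) ∨
          (n = 0 ∧ ∀ m, ¬ Q.Accepts st.z st.B (st.σ * Q.β ^ m))} := by
    ext st
    simp only [Set.mem_preimage, Set.mem_singleton_iff, Set.mem_ofPred_eq]
    set A := {i : ℕ | Q.Accepts st.z st.B (st.σ * Q.β ^ i)} with hA_def
    change sInf A = n ↔ (n ∈ A ∧ ∀ m < n, m ∉ A) ∨ (n = 0 ∧ ∀ m, m ∉ A)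
    constructor
    · rintro rfl
      rcases A.eq_empty_or_nonempty with h | h
      · right; rw [h]; simp
      · exact .inl ⟨Nat.sInf_mem h, fun m hm => Nat.notMem_of_lt_sInf hm⟩
    · rintro (⟨h1, h2⟩ | ⟨h1, h2⟩)
      · refine le_antisymm (Nat.sInf_le h1) ?_
        by_contra! hlt
        exact h2 _ hlt (Nat.sInf_mem ⟨n, h1⟩)
      · rw [Set.eq_empty_iff_forall_notMem.2 h2, h1, Nat.sInf_empty]
  rw [h1]
  simp only [Set.ofPred_or, Set.ofPred_and, Set.ofPred_forall]
  exact ((hA n).inter (.iInter fun m => .iInter fun _ => (hA m).compl)).union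
    ((MeasurableSet.const _).inter (.iInter fun m => (hA m).compl))

theorem measurable_stepSize : Measurable Q.stepSize :=
  State.measurable_σ.mul
    ((measurable_from_top (f := fun n : ℕ => Q.β ^ n)).comp (measurable_numBacktracks hF hsolver))

theorem measurable_zhat : Measurable Q.zhat :=
  measurable_trial hF hsolver State.measurable_z State.measurable_B
    (measurable_stepSize hF hsolver)

theorem measurable_ztilde : Measurable Q.ztilde :=
  measurable_trial hF hsolver State.measurable_z State.measurable_B
    (State.measurable_σ.mul ((measurable_from_top (f := fun n : ℕ => Q.β ^ (n - 1))).comp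
      (measurable_numBacktracks hF hsolver)))

theorem measurable_nextPoint : Measurable Q.nextPoint := by
  have h1 := measurable_stepSize hF hsolver
  have h2 := measurable_zhat hF hsolver
  have h3 := hF.measurable.comp h2
  have h4 : Measurable fun st => 1 / (1 + 2 * Q.stepSize st * Q.μ) := by fun_prop
  exact (h4.smul (State.measurable_z.sub (h1.smul h3))).add ((h4.const_sub 1).smul h2)

theorem measurable_grad : Measurable Q.grad := by
  have h2 := measurable_ztilde hF hsolver
  have h3 := hF.measurable.comp h2
  have h4 := hF.measurable.comp (State.measurable_z (d := d))
  refine Measurable.const_smul ((continuous_proj Q.S).measurable.comp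
    (measurable_lossGrad.comp (f := fun st : State d =>
      (Q.F (Q.ztilde st) - Q.F st.z, Q.ztilde st - st.z, st.B)) ?_)) (1 / Q.L₁)
  exact (h3.sub h4).prodMk ((h2.sub State.measurable_z).prodMk State.measurable_B)

theorem measurable_surrogateGrad : Measurable Q.surrogateGrad := by
  have h1 := measurable_grad hF hsolver
  have h2 : Measurable fun st => frobInner (Q.grad st) st.W :=
    h1.frobInner State.measurable_W
  have h3 := State.measurable_γ (d := d)
  have h4 : Measurable fun st => max 0 (-(1 / st.γ) * frobInner (Q.grad st) st.W) :=
    measurable_const.max ((h3.const_div 1).neg.mul h2)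
  unfold Method.surrogateGrad
  exact Measurable.ite (measurableSet_le h3 measurable_const) h1
    (h1.add (h4.smul State.measurable_S))

theorem measurable_nextW : Measurable Q.nextW := by
  have h1 : Measurable fun st => st.W - Q.ρ • Q.surrogateGrad st :=
    State.measurable_W.sub ((measurable_surrogateGrad hF hsolver).const_smul Q.ρ)
  have h2 := continuous_frobNorm.measurable.comp h1
  exact Measurable.smul ((h2.max measurable_const).const_div _) h1

end Iteration

theorem measurable_approx : Measurable fun p : Mat d × ℝ => Q.approx p.1 p.2 := by
  have h1 : Measurable fun p : Mat d × ℝ => if p.2 ≤ 1 then p.1 else (1 / p.2) • p.1 :=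
    Measurable.ite (measurableSet_le measurable_snd measurable_const) measurable_fst
      ((measurable_snd.const_div 1).smul measurable_fst)
  exact (h1.const_smul Q.L₁).add measurable_const

section Run

variable {Ξ₁ Ξ₂ : Type*} [MeasurableSpace Ξ₁] [MeasurableSpace Ξ₂]
  {ext : Oracle d Ξ₁} {svec : Oracle d Ξ₂}
  (hext : ∀ δ q : ℝ, Measurable fun x : Mat d × Ξ₁ => ext x.1 δ q x.2)
  (hsvec : ∀ δ q : ℝ, Measurable fun x : Mat d × Ξ₂ => svec x.1 δ q x.2)

include hext in
theorem measurable_ext_symPart (t : ℕ) :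
    Measurable fun x : Mat d × Ξ₁ => ext (symPart x.1) Q.δ (Q.q t / 2) x.2 :=
  (hext Q.δ (Q.q t / 2)).comp
    ((continuous_symPart.measurable.comp measurable_fst).prodMk measurable_snd)

include hext hsvec

theorem measurable_separate (t : ℕ) : Measurable fun x : Mat d × Ξ₁ × Ξ₂ =>
    Q.separate ext svec t x.1 x.2.1 x.2.2 := by
  have h1 : Measurable fun x : Mat d × Ξ₁ × Ξ₂ =>
      ext (symPart x.1) Q.δ (Q.q t / 2) x.2.1 :=
    (measurable_ext_symPart hext t).comp (measurable_fst.prodMk measurable_snd.fst)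
  have h2 : Measurable fun x : Mat d × Ξ₁ × Ξ₂ => svec x.1 Q.δ (Q.q t / 2) x.2.2 :=
    (hsvec _ _).comp (measurable_fst.prodMk measurable_snd.snd)
  exact Measurable.ite (measurableSet_le h2.fst h1.fst)
    (h1.fst.prodMk ((continuous_proj Q.S).measurable.comp h1.snd))
    (h2.fst.prodMk ((continuous_proj Q.S).measurable.comp h2.snd))

variable (hF : Continuous Q.F)
  (hsolver : Measurable fun x : Mat d × Vec d × ℝ => Q.solver x.1 x.2.1 x.2.2)
include hF hsolver

theorem measurable_step {X : Type*} [MeasurableSpace X] {st : X → State d} {ξ : X → Ξ₁ × Ξ₂}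
    (hst : Measurable st) (hξ : Measurable ξ) :
    Measurable fun x => Q.step ext svec (ξ x).1 (ξ x).2 (st x) := by
  have hn := (measurable_numBacktracks hF hsolver).comp hst
  have hz := (measurable_nextPoint hF hsolver).comp hst
  have hσ := ((measurable_stepSize hF hsolver).comp hst).div_const Q.β
  have hW := (measurable_nextW hF hsolver).comp hst
  have ht := (State.measurable_t.comp hst).add_const 1
  have hout : Measurable fun x =>
      Q.separate ext svec ((st x).t + 1) (Q.nextW (st x)) (ξ x).1 (ξ x).2 := by
    have h1 : Measurable fun y : ℕ × Mat d × Ξ₁ × Ξ₂ =>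
        Q.separate ext svec y.1 y.2.1 y.2.2.1 y.2.2.2 :=
      measurable_from_prod_countable_right fun t => measurable_separate hext hsvec t
    exact h1.comp (ht.prodMk (hW.prodMk hξ))
  refine Measurable.ite (hn (measurableSet_singleton 0)) ?_ ?_
  · rw [State.measurable_iff]
    have h1 : Measurable fun x => (st x).toProd.2.2 := State.measurable_toProd.snd.snd.comp hst
    exact hz.prodMk (hσ.prodMk h1)
  · rw [State.measurable_iff]
    exact hz.prodMk (hσ.prodMk ((measurable_approx.comp (hW.prodMk hout.fst)).prodMk
      (ht.prodMk (hW.prodMk (hout.fst.prodMk hout.snd)))))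

theorem measurable_run (k : ℕ) : Measurable fun x : ℕ → Ξ₁ × Ξ₂ =>
    Q.run ext svec (fun j => (x j).1) (fun j => (x j).2) k := by
  induction k with
  | zero => exact measurable_const
  | succ k ih => exact measurable_step hext hsvec hF hsolver ih (measurable_pi_apply k)

/-- The event, for the state at the beginning of an iteration and the seeds used in it, that round
`t + 1` of online learning takes place and an oracle answer is wrong. -/
theorem measurableSet_failure (t : ℕ) :
    MeasurableSet {x : State d × Ξ₁ × Ξ₂ |
      (Q.numBacktracks x.1 ≠ 0 ∧ x.1.t = t) ∧
        ¬ (ExtEvecGood (symPart (Q.nextW x.1)) Q.δ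
            (ext (symPart (Q.nextW x.1)) Q.δ (Q.q (t + 1) / 2) x.2.1) ∧
          MaxSvecGood (Q.nextW x.1) Q.δ (svec (Q.nextW x.1) Q.δ (Q.q (t + 1) / 2) x.2.2))} := by
  have hn : Measurable fun x : State d × Ξ₁ × Ξ₂ => Q.numBacktracks x.1 :=
    (measurable_numBacktracks hF hsolver).comp measurable_fst
  have ht : Measurable fun x : State d × Ξ₁ × Ξ₂ => x.1.t :=
    State.measurable_t.comp measurable_fst
  have hW : Measurable fun x : State d × Ξ₁ × Ξ₂ => Q.nextW x.1 :=
    (measurable_nextW hF hsolver).comp measurable_fst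
  have h1 : Measurable fun x : State d × Ξ₁ × Ξ₂ => (symPart (Q.nextW x.1),
      ext (symPart (Q.nextW x.1)) Q.δ (Q.q (t + 1) / 2) x.2.1) :=
    (continuous_symPart.measurable.comp hW).prodMk
      ((measurable_ext_symPart hext (t + 1)).comp (hW.prodMk measurable_snd.fst))
  have h2 : Measurable fun x : State d × Ξ₁ × Ξ₂ => (Q.nextW x.1,
      svec (Q.nextW x.1) Q.δ (Q.q (t + 1) / 2) x.2.2) :=
    hW.prodMk ((hsvec _ _).comp (hW.prodMk measurable_snd.snd))
  have h3 := measurableSet_preimage h1 (measurableSet_extEvecGood Q.δ)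
  have h4 := measurableSet_preimage h2 (measurableSet_maxSvecGood Q.δ)
  exact ((hn (measurableSet_singleton 0)).compl.inter (ht (measurableSet_singleton t))).inter
    (h3.inter h4).compl

end Run

end Method

/-! ### The failure probabilities -/

/-- The series `∑ 1 / (t log² t)` over `t ≥ 2` is at most `2.5`, by comparison of all but the first
term with the telescoping series of `1 / log (t - 1) - 1 / log t`. -/
theorem sum_one_div_mul_log_sq_le (n : ℕ) :
    ∑ s ∈ Finset.range n, 1 / (((s : ℝ) + 2) * Real.log ((s : ℝ) + 2) ^ 2) ≤ 2.5 := by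
  have key : ∀ m : ℕ, ∑ s ∈ Finset.range (m + 1), 1 / (((s : ℝ) + 2) * Real.log ((s : ℝ) + 2) ^ 2)
      ≤ 1 / (2 * Real.log 2 ^ 2) + 1 / Real.log 2 - 1 / Real.log ((m : ℝ) + 2) := by
    intro m
    induction m with
    | zero => simp
    | succ m ih =>
      rw [Finset.sum_range_succ]
      have hm : (0 : ℝ) ≤ m := m.cast_nonneg
      have h1 : 0 < Real.log ((m : ℝ) + 2) := Real.log_pos (by linarith)
      have h2 : Real.log ((m : ℝ) + 2) ≤ Real.log ((m : ℝ) + 3) :=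
        Real.log_le_log (by linarith) (by linarith)
      have h3 : 1 / ((m : ℝ) + 3) ≤ Real.log ((m : ℝ) + 3) - Real.log ((m : ℝ) + 2) := by
        have h4 := Real.log_le_sub_one_of_pos
          (show 0 < ((m : ℝ) + 2) / ((m : ℝ) + 3) by positivity)
        rw [Real.log_div (by positivity) (by positivity)] at h4
        have h5 : ((m : ℝ) + 2) / ((m : ℝ) + 3) - 1 = -(1 / ((m : ℝ) + 3)) := by
          field_simp; ring
        linarith
      have h6 : ((m + 1 : ℕ) : ℝ) + 2 = (m : ℝ) + 3 := by push_cast; ring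
      rw [h6]
      have h7 : 1 / (((m : ℝ) + 3) * Real.log ((m : ℝ) + 3) ^ 2)
          ≤ 1 / Real.log ((m : ℝ) + 2) - 1 / Real.log ((m : ℝ) + 3) := by
        have h8 : 0 < Real.log ((m : ℝ) + 3) := h1.trans_le h2
        rw [div_sub_div _ _ h1.ne' h8.ne', one_mul, mul_one, ← div_div]
        refine div_le_div₀ (by linarith [show 0 < 1 / ((m : ℝ) + 3) by positivity]) h3
          (by positivity) ?_
        rw [sq]
        gcongr
      linarith
  have hl := Real.log_two_gt_d9
  cases n with
  | zero => norm_num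
  | succ m =>
    refine (key m).trans ?_
    have h1 : 0 ≤ 1 / Real.log ((m : ℝ) + 2) :=
      one_div_nonneg.2 (Real.log_nonneg (by linarith [(m.cast_nonneg : (0 : ℝ) ≤ m)]))
    have h2 : 1 / (2 * Real.log 2 ^ 2) ≤ 1 / (2 * 0.693 ^ 2) := by
      gcongr; linarith
    have h3 : 1 / Real.log 2 ≤ 1 / 0.693 := by
      gcongr; linarith
    have h4 : 1 / (2 * 0.693 ^ 2) + 1 / 0.693 ≤ (2.5 : ℝ) := by norm_num
    linarith

theorem measure_compl_le_of_ofReal_le {X : Type*} [MeasurableSpace X] {ν : Measure X}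
    [IsProbabilityMeasure ν] {s : Set X} (hs : MeasurableSet s) {q : ℝ}
    (h : ENNReal.ofReal (1 - q) ≤ ν s) : ν sᶜ ≤ ENNReal.ofReal q := by
  rw [prob_compl_eq_one_sub hs, tsub_le_iff_right]
  calc (1 : ENNReal) = ENNReal.ofReal (q + (1 - q)) := by simp
    _ ≤ ENNReal.ofReal q + ENNReal.ofReal (1 - q) := ENNReal.ofReal_add_le
    _ ≤ _ := by gcongr

namespace Method

variable (Q : Method d)

theorem run_congr {Ξ₁ Ξ₂ : Type*} {ext : Oracle d Ξ₁} {svec : Oracle d Ξ₂} {ξ₁ ξ₁' : ℕ → Ξ₁}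
    {ξ₂ ξ₂' : ℕ → Ξ₂} (k : ℕ) (h₁ : ∀ j < k, ξ₁ j = ξ₁' j) (h₂ : ∀ j < k, ξ₂ j = ξ₂' j) :
    Q.run ext svec ξ₁ ξ₂ k = Q.run ext svec ξ₁' ξ₂' k := by
  induction k with
  | zero => rfl
  | succ k ih =>
    rw [Method.run, Method.run, h₁ k k.lt_succ_self, h₂ k k.lt_succ_self,
      ih (fun j hj => h₁ j (hj.trans k.lt_succ_self)) fun j hj => h₂ j (hj.trans k.lt_succ_self)]

theorem step_t {Ξ₁ Ξ₂ : Type*} (ext : Oracle d Ξ₁) (svec : Oracle d Ξ₂) (ξ₁ : Ξ₁) (ξ₂ : Ξ₂)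
    (st : State d) :
    (Q.step ext svec ξ₁ ξ₂ st).t = if Q.numBacktracks st = 0 then st.t else st.t + 1 := by
  rw [Method.step]; split_ifs <;> rfl

theorem monotone_run_t {Ξ₁ Ξ₂ : Type*} (ext : Oracle d Ξ₁) (svec : Oracle d Ξ₂) (ξ₁ : ℕ → Ξ₁)
    (ξ₂ : ℕ → Ξ₂) : Monotone fun k => (Q.run ext svec ξ₁ ξ₂ k).t := by
  refine monotone_nat_of_le_succ fun k => ?_
  rw [Method.run, step_t]
  split_ifs <;> omega

variable {Q}
variable {Ξ₁ Ξ₂ : Type*} [MeasurableSpace Ξ₁] [MeasurableSpace Ξ₂]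
  {ν₁ : Measure Ξ₁} {ν₂ : Measure Ξ₂}
  {ext : Oracle d Ξ₁} {svec : Oracle d Ξ₂}
  (hext : IsExtEvec ν₁ ext) (hsvec : IsMaxSvec ν₂ svec)
  {Ω : Type*} [MeasurableSpace Ω] {P : Measure Ω}
  {ξ₁ : ℕ → Ω → Ξ₁} {ξ₂ : ℕ → Ω → Ξ₂}
  (hξ₁ : ∀ k, Measurable (ξ₁ k)) (hξ₂ : ∀ k, Measurable (ξ₂ k))
  (hlaw₁ : ∀ k, P.map (ξ₁ k) = ν₁) (hlaw₂ : ∀ k, P.map (ξ₂ k) = ν₂)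
  (hindep : iIndepFun (fun (k : ℕ) (ω : Ω) => (ξ₁ k ω, ξ₂ k ω)) P)
  (hF : Continuous Q.F)
  (hsolver : Measurable fun x : Mat d × Vec d × ℝ => Q.solver x.1 x.2.1 x.2.2)

include hext hsvec hF hsolver hξ₁ hξ₂ in
theorem measurable_run_comp (k : ℕ) :
    Measurable fun ω => Q.run ext svec (fun j => ξ₁ j ω) (fun j => ξ₂ j ω) k :=
  (measurable_run hext.1 hsvec.1 hF hsolver k).comp
    (measurable_pi_lambda _ fun j => (hξ₁ j).prodMk (hξ₂ j))

variable [IsProbabilityMeasure P]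

include hext hsvec hlaw₁ hlaw₂ hξ₁ hξ₂ in
/-- At a fixed matrix the two oracle answers of round `t` are both correct with probability at
least `1 - q t`. -/
theorem measure_oracle_failure_le (hδ : 0 < Q.δ) {t : ℕ} (hq0 : 0 < Q.q t) (hq1 : Q.q t < 2)
    (k : ℕ) (W : Mat d) :
    P.map (fun ω => (ξ₁ k ω, ξ₂ k ω)) {x : Ξ₁ × Ξ₂ |
      ¬ (ExtEvecGood (symPart W) Q.δ (ext (symPart W) Q.δ (Q.q t / 2) x.1) ∧
        MaxSvecGood W Q.δ (svec W Q.δ (Q.q t / 2) x.2))} ≤ ENNReal.ofReal (Q.q t) := by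
  have : IsProbabilityMeasure ν₁ :=
    hlaw₁ k ▸ Measure.isProbabilityMeasure_map (hξ₁ k).aemeasurable
  have : IsProbabilityMeasure ν₂ :=
    hlaw₂ k ▸ Measure.isProbabilityMeasure_map (hξ₂ k).aemeasurable
  have m1 : MeasurableSet {ξ | ExtEvecGood (symPart W) Q.δ
      (ext (symPart W) Q.δ (Q.q t / 2) ξ)} :=
    measurableSet_preimage (measurable_const.prodMk
      ((hext.1 Q.δ (Q.q t / 2)).comp measurable_prodMk_left)) (measurableSet_extEvecGood Q.δ)
  have m2 : MeasurableSet {ξ | MaxSvecGood W Q.δ (svec W Q.δ (Q.q t / 2) ξ)} :=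
    measurableSet_preimage (measurable_const.prodMk
      ((hsvec.1 Q.δ (Q.q t / 2)).comp measurable_prodMk_left)) (measurableSet_maxSvecGood Q.δ)
  have b1 := measure_compl_le_of_ofReal_le m1
    (hext.2 (symPart W) Q.δ (Q.q t / 2) hδ (by linarith) (by linarith))
  have b2 := measure_compl_le_of_ofReal_le m2
    (hsvec.2 W Q.δ (Q.q t / 2) hδ (by linarith) (by linarith))
  have hξ : Measurable fun ω => (ξ₁ k ω, ξ₂ k ω) := (hξ₁ k).prodMk (hξ₂ k)
  rw [← hlaw₁ k, Measure.map_apply (hξ₁ k) m1.compl] at b1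
  rw [← hlaw₂ k, Measure.map_apply (hξ₂ k) m2.compl] at b2
  have m3 : MeasurableSet {x : Ξ₁ × Ξ₂ |
      ¬ (ExtEvecGood (symPart W) Q.δ (ext (symPart W) Q.δ (Q.q t / 2) x.1) ∧
        MaxSvecGood W Q.δ (svec W Q.δ (Q.q t / 2) x.2))} :=
    ((measurable_fst m1).inter (measurable_snd m2)).compl
  rw [Measure.map_apply hξ m3]
  calc _ ≤ P (ξ₁ k ⁻¹' {ξ | ExtEvecGood (symPart W) Q.δ
          (ext (symPart W) Q.δ (Q.q t / 2) ξ)}ᶜ ∪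
        ξ₂ k ⁻¹' {ξ | MaxSvecGood W Q.δ (svec W Q.δ (Q.q t / 2) ξ)}ᶜ) :=
      measure_mono fun ω hω => not_and_or.1 hω
    _ ≤ ENNReal.ofReal (Q.q t / 2) + ENNReal.ofReal (Q.q t / 2) :=
      (measure_union_le _ _).trans (add_le_add b1 b2)
    _ = _ := by rw [← ENNReal.ofReal_add (by linarith) (by linarith), add_halves]

include hext hsvec hF hsolver hξ₁ hξ₂

include hindep

/-- The state at the beginning of an iteration is independent of the seeds used in it. -/
theorem indepFun_run (k : ℕ) :
    IndepFun (fun ω => Q.run ext svec (fun j => ξ₁ j ω) (fun j => ξ₂ j ω) k)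
      (fun ω => (ξ₁ k ω, ξ₂ k ω)) P := by
  classical
  obtain ⟨ω₀⟩ : Nonempty Ω := P.nonempty_of_neZero
  have h1 := hindep.indepFun_finset (Finset.range k) {k} (by simp)
    fun j => (hξ₁ j).prodMk (hξ₂ j)
  -- the state as a function of the earlier seeds; the later ones are irrelevant
  have hG : Measurable fun y : (i : Finset.range k) → Ξ₁ × Ξ₂ =>
      (fun j => if hj : j ∈ Finset.range k then y ⟨j, hj⟩ else (ξ₁ j ω₀, ξ₂ j ω₀) :
        ℕ → Ξ₁ × Ξ₂) := by
    refine measurable_pi_lambda _ fun j => ?_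
    by_cases hj : j ∈ Finset.range k
    · simp only [hj, dif_pos]; exact measurable_pi_apply _
    · simp only [hj, dif_neg, not_false_eq_true]; exact measurable_const
  have h2 := h1.comp ((measurable_run hext.1 hsvec.1 hF hsolver k).comp hG)
    (measurable_pi_apply (⟨k, Finset.mem_singleton_self k⟩ : ({k} : Finset ℕ)))
  refine h2.congr (ae_of_all _ fun ω => ?_) (ae_of_all _ fun ω => rfl)
  refine Q.run_congr k (fun j hj => ?_) fun j hj => ?_ <;> simp [hj]

include hlaw₁ hlaw₂

theorem measure_failure_le (hδ : 0 < Q.δ) {t : ℕ} (hq0 : 0 < Q.q (t + 1)) (hq1 : Q.q (t + 1) < 2)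
    (k : ℕ) :
    P {ω | (Q.numBacktracks (Q.run ext svec (fun j => ξ₁ j ω) (fun j => ξ₂ j ω) k) ≠ 0 ∧
        (Q.run ext svec (fun j => ξ₁ j ω) (fun j => ξ₂ j ω) k).t = t) ∧
        ¬ Q.RoundGood ext svec (Q.run ext svec (fun j => ξ₁ j ω) (fun j => ξ₂ j ω) k)
          (ξ₁ k ω) (ξ₂ k ω)}
      ≤ ENNReal.ofReal (Q.q (t + 1)) *
        P {ω | Q.numBacktracks (Q.run ext svec (fun j => ξ₁ j ω) (fun j => ξ₂ j ω) k) ≠ 0 ∧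
          (Q.run ext svec (fun j => ξ₁ j ω) (fun j => ξ₂ j ω) k).t = t} := by
  set X : Ω → State d := fun ω => Q.run ext svec (fun j => ξ₁ j ω) (fun j => ξ₂ j ω) k with hX_def
  set Y : Ω → Ξ₁ × Ξ₂ := fun ω => (ξ₁ k ω, ξ₂ k ω) with hY_def
  have hX : Measurable X := measurable_run_comp hext hsvec hξ₁ hξ₂ hF hsolver k
  have hY : Measurable Y := (hξ₁ k).prodMk (hξ₂ k)
  have hmap := (indepFun_iff_map_prod_eq_prod_map_map hX.aemeasurable hY.aemeasurable).1
    (indepFun_run hext hsvec hξ₁ hξ₂ hindep hF hsolver k)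
  have hA := measurableSet_failure hext.1 hsvec.1 hF hsolver t
  set A := {x : State d × Ξ₁ × Ξ₂ |
      (Q.numBacktracks x.1 ≠ 0 ∧ x.1.t = t) ∧
        ¬ (ExtEvecGood (symPart (Q.nextW x.1)) Q.δ
            (ext (symPart (Q.nextW x.1)) Q.δ (Q.q (t + 1) / 2) x.2.1) ∧
          MaxSvecGood (Q.nextW x.1) Q.δ (svec (Q.nextW x.1) Q.δ (Q.q (t + 1) / 2) x.2.2))}
  have hS : MeasurableSet {s : State d | Q.numBacktracks s ≠ 0 ∧ s.t = t} :=
    ((measurable_numBacktracks hF hsolver) (measurableSet_singleton 0)).compl.inter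
      (State.measurable_t (measurableSet_singleton t))
  have : IsProbabilityMeasure (P.map Y) := Measure.isProbabilityMeasure_map hY.aemeasurable
  calc _ ≤ P ((fun ω => (X ω, Y ω)) ⁻¹' A) := by
        refine measure_mono ?_
        rintro ω ⟨⟨h1, h2⟩, h3⟩
        refine ⟨⟨h1, h2⟩, fun h4 => h3 fun _ => ?_⟩
        change ExtEvecGood _ _ (ext _ _ (Q.q ((X ω).t + 1) / 2) _) ∧
          MaxSvecGood _ _ (svec _ _ (Q.q ((X ω).t + 1) / 2) _)
        rw [show (X ω).t = t from h2]
        exact h4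
    _ = ((P.map X).prod (P.map Y)) A := by
        rw [← hmap, Measure.map_apply (hX.prodMk hY) hA]
    _ = ∫⁻ s, P.map Y (Prod.mk s ⁻¹' A) ∂(P.map X) := Measure.prod_apply hA
    _ ≤ ∫⁻ s, {s : State d | Q.numBacktracks s ≠ 0 ∧ s.t = t}.indicator
          (fun _ => ENNReal.ofReal (Q.q (t + 1))) s ∂(P.map X) := by
        refine lintegral_mono fun s => ?_
        by_cases hs : s ∈ {s : State d | Q.numBacktracks s ≠ 0 ∧ s.t = t}
        · rw [Set.indicator_of_mem hs]
          exact (measure_mono fun x hx => hx.2).trans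
            (measure_oracle_failure_le hext hsvec hξ₁ hξ₂ hlaw₁ hlaw₂ hδ hq0 hq1 k (Q.nextW s))
        · rw [Set.indicator_of_notMem hs, show Prod.mk s ⁻¹' A = ∅ from
            Set.eq_empty_of_forall_notMem fun x hx => hs hx.1, measure_empty]
    _ = ENNReal.ofReal (Q.q (t + 1)) *
          P.map X {s : State d | Q.numBacktracks s ≠ 0 ∧ s.t = t} := lintegral_indicator_const hS _
    _ = _ := by rw [Measure.map_apply hX hS]; rfl

/-- Each round of online learning takes place in at most one iteration, so its failure
probability is counted only once. -/
theorem measure_exists_failure_le (hδ : 0 < Q.δ) {t : ℕ} (hq0 : 0 < Q.q (t + 1))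
    (hq1 : Q.q (t + 1) < 2) :
    P {ω | ∃ k, (Q.numBacktracks (Q.run ext svec (fun j => ξ₁ j ω) (fun j => ξ₂ j ω) k) ≠ 0 ∧
        (Q.run ext svec (fun j => ξ₁ j ω) (fun j => ξ₂ j ω) k).t = t) ∧
        ¬ Q.RoundGood ext svec (Q.run ext svec (fun j => ξ₁ j ω) (fun j => ξ₂ j ω) k)
          (ξ₁ k ω) (ξ₂ k ω)} ≤ ENNReal.ofReal (Q.q (t + 1)) := by
  simp only [Set.ofPred_exists]
  set D : ℕ → Set Ω := fun k =>
    {ω | Q.numBacktracks (Q.run ext svec (fun j => ξ₁ j ω) (fun j => ξ₂ j ω) k) ≠ 0 ∧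
      (Q.run ext svec (fun j => ξ₁ j ω) (fun j => ξ₂ j ω) k).t = t}
  have hD : ∀ k, MeasurableSet (D k) := fun k => by
    have h1 := measurable_run_comp hext hsvec hξ₁ hξ₂ hF hsolver k
    exact (((measurable_numBacktracks hF hsolver).comp h1) (measurableSet_singleton 0)).compl.inter
      ((State.measurable_t.comp h1) (measurableSet_singleton t))
  have hdisj : Pairwise (Function.onFun Disjoint D) := by
    rw [pairwise_disjoint_on]
    intro k l hkl
    rw [Set.disjoint_left]
    rintro ω ⟨h1, h2⟩ ⟨-, h3⟩
    have h4 := Q.monotone_run_t ext svec (fun j => ξ₁ j ω) (fun j => ξ₂ j ω)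
      (Nat.succ_le_of_lt hkl)
    simp only [Method.run, step_t, if_neg h1, h2, h3] at h4
    omega
  calc _ ≤ ∑' k, P _ := measure_iUnion_le _
    _ ≤ ∑' k, ENNReal.ofReal (Q.q (t + 1)) * P (D k) := ENNReal.tsum_le_tsum fun k =>
      measure_failure_le hext hsvec hξ₁ hξ₂ hlaw₁ hlaw₂ hindep hF hsolver hδ hq0 hq1 k
    _ = ENNReal.ofReal (Q.q (t + 1)) * ∑' k, P (D k) := ENNReal.tsum_mul_left
    _ ≤ ENNReal.ofReal (Q.q (t + 1)) * 1 := by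
      gcongr
      rw [← measure_iUnion hdisj hD]
      exact prob_le_one
    _ = _ := mul_one _

/-- With probability at least `1 - p` all oracle answers are correct. -/
theorem measure_not_roundGood_le (hδ : 0 < Q.δ) {p : ℝ} (hp : p ∈ Set.Ioo (0 : ℝ) 1)
    (hq : ∀ t : ℕ, 1 ≤ t → Q.q t = p / (2.5 * ((t : ℝ) + 1) * Real.log ((t : ℝ) + 1) ^ 2)) :
    P {ω | ¬ ∀ k, Q.RoundGood ext svec (Q.run ext svec (fun j => ξ₁ j ω) (fun j => ξ₂ j ω) k)
      (ξ₁ k ω) (ξ₂ k ω)} ≤ ENNReal.ofReal p := by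
  have hqs : ∀ t : ℕ, Q.q (t + 1)
      = p / 2.5 * (1 / (((t : ℝ) + 2) * Real.log ((t : ℝ) + 2) ^ 2)) := by
    intro t
    rw [hq (t + 1) (by omega), show ((t + 1 : ℕ) : ℝ) + 1 = (t : ℝ) + 2 by push_cast; ring]
    rw [div_mul_div_comm, mul_one, mul_assoc]
  have hpos : ∀ t : ℕ, 0 < 1 / (((t : ℝ) + 2) * Real.log ((t : ℝ) + 2) ^ 2) := fun t => by
    have h1 : 0 < Real.log ((t : ℝ) + 2) :=
      Real.log_pos (by linarith [(t.cast_nonneg : (0 : ℝ) ≤ t)])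
    positivity
  have hp0 := hp.1
  have hq0 : ∀ t, 0 < Q.q (t + 1) := fun t => by
    rw [hqs]; exact mul_pos (by positivity) (hpos t)
  have hsum : ∀ n, ∑ t ∈ Finset.range n, Q.q (t + 1) ≤ p := fun n => by
    simp only [hqs]
    rw [← Finset.mul_sum]
    have := mul_le_mul_of_nonneg_left (sum_one_div_mul_log_sq_le n)
      (by positivity : 0 ≤ p / 2.5)
    rwa [div_mul_cancel₀ p (by norm_num)] at this
  have hq1 : ∀ t, Q.q (t + 1) < 2 := fun t => by
    have h1 := Finset.single_le_sum (f := fun t => Q.q (t + 1)) (fun i _ => (hq0 i).le)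
      (Finset.self_mem_range_succ t)
    linarith [hsum (t + 1), hp.2]
  calc _ ≤ P (⋃ t, {ω | ∃ k,
          (Q.numBacktracks (Q.run ext svec (fun j => ξ₁ j ω) (fun j => ξ₂ j ω) k) ≠ 0 ∧
          (Q.run ext svec (fun j => ξ₁ j ω) (fun j => ξ₂ j ω) k).t = t) ∧
          ¬ Q.RoundGood ext svec (Q.run ext svec (fun j => ξ₁ j ω) (fun j => ξ₂ j ω) k)
            (ξ₁ k ω) (ξ₂ k ω)}) := by
        refine measure_mono fun ω hω => ?_
        obtain ⟨k, hk⟩ := not_forall.1 hω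
        exact Set.mem_iUnion.2 ⟨_, k, ⟨fun h0 => hk fun h1 => absurd h0 h1, rfl⟩, hk⟩
    _ ≤ ∑' t, ENNReal.ofReal (Q.q (t + 1)) := (measure_iUnion_le _).trans
      (ENNReal.tsum_le_tsum fun t => measure_exists_failure_le hext hsvec hξ₁ hξ₂ hlaw₁ hlaw₂
        hindep hF hsolver hδ (hq0 t) (hq1 t))
    _ ≤ ENNReal.ofReal p := by
      refine ENNReal.tsum_le_of_sum_range_le fun n => ?_
      rw [← ENNReal.ofReal_sum_of_nonneg fun t _ => (hq0 t).le]
      exact ENNReal.ofReal_le_ofReal (hsum n)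

end Method

end QNPE

theorem theorem6p1 {d : ℕ} (Q : QNPE.Method d) (zs : QNPE.Vec d) (L₂ p : ℝ)
    -- assumptions on the operator; `zs` is its zero
    (hF : ContDiff ℝ 1 Q.F)
    (hμ : 0 < Q.μ)
    (hmono : ∀ z z' : QNPE.Vec d, Q.μ * ‖z - z'‖ ^ 2 ≤ inner ℝ (Q.F z - Q.F z') (z - z'))
    (hL₁ : 0 < Q.L₁)
    (hLip : ∀ z z' : QNPE.Vec d, ‖Q.F z - Q.F z'‖ ≤ Q.L₁ * ‖z - z'‖)
    (hJac : ∀ z z' : QNPE.Vec d,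
      QNPE.opNorm (QNPE.jacobian Q.F z - QNPE.jacobian Q.F z') ≤ L₂ * ‖z - z'‖)
    (hzs : Q.F zs = 0)
    -- the subspace of structured matrices, the initial matrix and the radius
    (hone : (1 : QNPE.Mat d) ∈ Q.S)
    (hstruct : QNPE.jacobian Q.F zs ∈ Q.S)
    (hB₀ : Q.B₀ ∈ QNPE.feasible Q.μ Q.L₁ Q.S)
    (hR : 0 < Q.R)
    (hball : ∀ X ∈ QNPE.learnSet Q.S, QNPE.frobNorm X ≤ Q.R)
    -- line search
    (hα₁ : Q.α₁ ∈ Set.Ioo (0 : ℝ) (1 / 2))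
    (hα₂ : Q.α₂ ∈ Set.Ioo (0 : ℝ) (1 / 2))
    (hβ : Q.β ∈ Set.Ioo (0 : ℝ) 1)
    (hσ₀ : Q.α₂ * Q.β / (7.5 * Q.L₁) ≤ Q.σ₀)
    (hsolver : QNPE.IsLinearSolver Q.solver)
    (hsolver_meas : Measurable fun x : QNPE.Mat d × QNPE.Vec d × ℝ => Q.solver x.1 x.2.1 x.2.2)
    -- parameters of the Jacobian approximation update
    (hp : p ∈ Set.Ioo (0 : ℝ) 1)
    (hρ : Q.ρ = 1 / 121)
    (hδ : Q.δ = Q.μ / (2 * Q.L₁))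
    (hq : ∀ t : ℕ, 1 ≤ t → Q.q t = p / (2.5 * ((t : ℝ) + 1) * Real.log ((t : ℝ) + 1) ^ 2))
    -- the randomized matrix oracles
    {Ξ₁ Ξ₂ : Type*} [MeasurableSpace Ξ₁] [MeasurableSpace Ξ₂]
    (ν₁ : Measure Ξ₁) [IsProbabilityMeasure ν₁] (ν₂ : Measure Ξ₂) [IsProbabilityMeasure ν₂]
    (ext : QNPE.Oracle d Ξ₁) (svec : QNPE.Oracle d Ξ₂)
    (hext : QNPE.IsExtEvec ν₁ ext) (hsvec : QNPE.IsMaxSvec ν₂ svec)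
    -- the random seeds: fresh (independent of the past) in every iteration
    {Ω : Type*} [MeasurableSpace Ω] (P : Measure Ω) [IsProbabilityMeasure P]
    (ξ₁ : ℕ → Ω → Ξ₁) (ξ₂ : ℕ → Ω → Ξ₂)
    (hξ₁ : ∀ k, Measurable (ξ₁ k)) (hξ₂ : ∀ k, Measurable (ξ₂ k))
    (hlaw₁ : ∀ k, P.map (ξ₁ k) = ν₁) (hlaw₂ : ∀ k, P.map (ξ₂ k) = ν₂)
    (hindep : iIndepFun (fun (k : ℕ) (ω : Ω) => (ξ₁ k ω, ξ₂ k ω)) P)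
    -- the iterates
    (z : ℕ → Ω → QNPE.Vec d)
    (hz : ∀ k ω, z k ω = (Q.run ext svec (fun j => ξ₁ j ω) (fun j => ξ₂ j ω) k).z) :
    ENNReal.ofReal (1 - p) ≤ P {ω |
      (∀ k : ℕ, ‖z (k + 1) ω - zs‖ ^ 2
        ≤ (1 + 4 * Q.α₂ * Q.β * Q.μ / (15 * Q.L₁))⁻¹ * ‖z k ω - zs‖ ^ 2) ∧
      Tendsto (fun k : ℕ => ‖z (k + 1) ω - zs‖ ^ 2 / ‖z k ω - zs‖ ^ 2) atTop (𝓝 0) ∧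
      (∀ k : ℕ, ‖z k ω - zs‖ ^ 2
        ≤ ((1 + (1 - Q.β) * Q.α₂ * Q.β * Q.μ / Q.L₁
            * QNPE.Method.rate (Q.constM L₂ zs) k) ^ k)⁻¹ * ‖z 0 ω - zs‖ ^ 2)} := by
  rcases Nat.eq_zero_or_pos d with rfl | hd
  -- in dimension `0` all points coincide
  · refine le_trans (ENNReal.ofReal_le_one.2 (by linarith [hp.1])) ?_
    rw [← measure_univ (μ := P)]
    refine measure_mono fun ω _ => ?_
    have hzero : ∀ x y : QNPE.Vec 0, ‖x - y‖ = 0 := fun x y => by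
      rw [Subsingleton.elim x y, sub_self, norm_zero]
    simp [hzero]
  have : Nonempty (Fin d) := ⟨⟨0, hd⟩⟩
  obtain ⟨v, hv⟩ := exists_ne (0 : QNPE.Vec d)
  have hv0 : 0 < ‖v - 0‖ := by simpa using hv
  have hμL : Q.μ ≤ Q.L₁ := by
    have h1 := (hmono v 0).trans ((real_inner_le_norm _ _).trans
      (mul_le_mul_of_nonneg_right (hLip v 0) (norm_nonneg _)))
    rw [mul_assoc, ← sq] at h1
    exact le_of_mul_le_mul_right h1 (by positivity)
  have hL₂ : 0 ≤ L₂ :=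
    nonneg_of_mul_nonneg_left ((QNPE.opNorm_nonneg _).trans (hJac v 0)) hv0
  have h : Q.Admissible zs L₂ := ⟨hF, hμ, hmono, hL₁, hLip, hJac, hzs, hone, hstruct, hB₀, hR,
    hball, hα₁, hα₂, hβ, hσ₀, hsolver, hρ, hδ, hμL, hL₂⟩
  have hbad := QNPE.Method.measure_not_roundGood_le hext hsvec hξ₁ hξ₂ hlaw₁ hlaw₂ hindep
    hF.continuous hsolver_meas h.δ_pos hp hq
  set good : Set Ω := {ω | ∀ k, Q.RoundGood ext svec
    (Q.run ext svec (fun j => ξ₁ j ω) (fun j => ξ₂ j ω) k) (ξ₁ k ω) (ξ₂ k ω)}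
  have hbad : P goodᶜ ≤ ENNReal.ofReal p := hbad
  refine le_trans ?_ (measure_mono (s := good) fun ω hω => ?_)
  · rw [ENNReal.ofReal_sub _ hp.1.le, ENNReal.ofReal_one, tsub_le_iff_right]
    calc (1 : ENNReal) = P (good ∪ goodᶜ) := by rw [Set.union_compl_self, measure_univ]
      _ ≤ P good + P goodᶜ := measure_union_le _ _
      _ ≤ _ := add_le_add le_rfl hbad
  · have hrun := h.goodRun_run hω
    simp only [hz]
    exact ⟨h.linear_convergence hrun, h.superlinear_convergence hrun,
      h.explicit_convergence hrun⟩
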